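/- Let $\Omega=(0,1)^2$, $1<\alpha,\beta<2$, $T>0$. Write $(\cdot,\cdot)$, $\|\cdot\|$ for the inner product and norm of $L^2(\Omega)$, put $C_\gamma=\frac1{2\cos(\gamma\pi/2)}$ and, with the left and right Riemann–Liouville derivatives on $(0,1)$ in the variable indicated, $$a(u,v)=(u,v)_w=C_\alpha({}_0D_x^{\alpha/2}u,{}_xD_1^{\alpha/2}v)+C_\alpha({}_xD_1^{\alpha/2}u,{}_0D_x^{\alpha/2}v)+C_\beta({}_0D_y^{\beta/2}u,{}_yD_1^{\beta/2}v)+C_\beta({}_yD_1^{\beta/2}u,{}_0D_y^{\beta/2}v),\qquad \|u\|_w^2=a(u,u).$$ For a triangulation $\mathfrak T_h$ of $\Omega$ and $m\ge1$ let $X_h\subset H_0^{\alpha/2}(\Omega)\cap H_0^{\beta/2}(\Omega)\cap C^0$ be the space of continuous functions, zero outside $\Omega$, that are polynomials of degree $\le m$ on each triangle. Let $f(t)\in L^2(\Omega)$ for $t\in[0,T]$, $N\ge1$, $\tau=T/N$, $f^n=f(n\tau)$, and let $u_h^0,\dots,u_h^N\in X_h$ satisfy $$(u_h^n,v)+\tau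 a(u_h^n,v)=\tau(f^n,v)+(u_h^{n-1},v)\qquad\forall v\in X_h,\ 1\le n\le N.$$ Choose snapshots $U_i=u_h^{n_i}$, $1\le n_1\le\dots\le n_L\le N$, not all zero; let $l=\dim\operatorname{span}\{U_i\}$, let $\lambda_1\ge\dots\ge\lambda_l>0$ be the positive eigenvalues of $G=\big(\tfrac1L(U_i,U_j)_w\big)_{i,j}$ with orthonormal eigenvectors $(a_i^k)_i$, and put $\psi_k=\frac1{\sqrt{L\lambda_k}}\sum_i a_i^kU_i$. For $1\le d\le l$ let $W^d=\operatorname{span}\{\psi_1,\dots,\psi_d\}$ and let $u_d^0,\dots,u_d^N\in W^d$ solve the reduced scheme $$(u_d^n,v)+\tau a(u_d^n,v)=\tau(f^n,v)+(u_d^{n-1},v)\quad\forall v\in W^d,\ 1\le n\le N,\qquad a(u_d^0,v)=a(u_h^0,v)\quad\forall v\in W^d .$$ 1. (Unconditional stability.) For every $\varepsilon>0$ there is a constant $C$ depending only on $\varepsilon$ and $T$ such that always, for $0\le n\le N$, $$\|u_d^n\|^2+2\tau\sum_{i=1}^n\|u_d^i\|_w^2\le C\tau\sum_{i=1}^n\|f^i\|^2+(1+\varepsilon)\|u_d^0\|^2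 .$$ 2. (Error estimate.) Suppose the snapshots are taken at uniform intervals from all of $1,\dots,N$, i.e. $n_1,\dots,n_L$ are all the numbers in $\{1,\dots,N\}$ of the form $r+is$, $i\ge0$, where $1\le r\le s$, and that $L$ is of the order of $N$: $N\le\sigma L$ for a constant $\sigma$ (while $L\le N$). Then for $0\le n\le N$ $$\|u_h^n-u_d^n\|\le ML\Big(\sum_{j=d+1}^l\lambda_j\Big)^{1/2}+M\tau ,$$ where (a) if $t\mapsto f(t)\in L^2(\Omega)$ is Lipschitz on $[0,T]$, $M$ depends only on $\alpha,\beta,T,\sigma$, $X_h$, $f$ and $u_h^0$ (not on $N,L$, the snapshots, $d$ or $n$); (b) for every $f$ as above, $M$ can be chosen depending only on $\alpha,\beta,T,\sigma$ and a number $K>0$ such that $\|u_h^{n+1}-u_h^n\|_w\le K\tau$ $(0\le n<N)$ and $\|u_h^{n+2}-2u_h^{n+1}+u_h^n\|_w\le K\tau^2$ $(0\le n\le N-2)$; in particular not on the mesh. -/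

import Mathlib

open MeasureTheory Set
open scoped FourierTransform ENNReal ContDiff

noncomputable section

namespace RieszPOD

/-- The domain `Ω = (0,1) × (0,1)`. -/
def Omega : Set (ℝ × ℝ) := Ioo (0 : ℝ) 1 ×ˢ Ioo (0 : ℝ) 1

/-- The inner product `(u, v)` of `L²(Ω)`. -/
def ip (u v : ℝ × ℝ → ℝ) : ℝ := ∫ z in Omega, u z * v z

/-- The norm `‖u‖` of `L²(Ω)`. -/
def l2norm (u : ℝ × ℝ → ℝ) : ℝ := Real.sqrt (ip u u)

/-! ### Riemann-Liouville derivatives of order `0 < μ < 1` and the energy form -/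

/-- Left-sided Riemann-Liouville derivative of order `0 < μ < 1` with base point `a`. -/
def rlLeft (μ a : ℝ) (g : ℝ → ℝ) (x : ℝ) : ℝ :=
  1 / Real.Gamma (1 - μ) * deriv (fun s => ∫ ξ in a..s, (s - ξ) ^ (-μ) * g ξ) x

/-- Right-sided Riemann-Liouville derivative of order `0 < μ < 1` with base point `b`. -/
def rlRight (μ b : ℝ) (g : ℝ → ℝ) (x : ℝ) : ℝ :=
  (-1) / Real.Gamma (1 - μ) * deriv (fun s => ∫ ξ in s..b, (ξ - s) ^ (-μ) * g ξ) x

/-- `₀D_x^μ u`. -/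
def dxLeft (μ : ℝ) (u : ℝ × ℝ → ℝ) (z : ℝ × ℝ) : ℝ := rlLeft μ 0 (fun ξ => u (ξ, z.2)) z.1

/-- `ₓD_1^μ u`. -/
def dxRight (μ : ℝ) (u : ℝ × ℝ → ℝ) (z : ℝ × ℝ) : ℝ := rlRight μ 1 (fun ξ => u (ξ, z.2)) z.1

/-- `₀D_y^μ u`. -/
def dyLeft (μ : ℝ) (u : ℝ × ℝ → ℝ) (z : ℝ × ℝ) : ℝ := rlLeft μ 0 (fun η => u (z.1, η)) z.2

/-- `ᵧD_1^μ u`. -/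
def dyRight (μ : ℝ) (u : ℝ × ℝ → ℝ) (z : ℝ × ℝ) : ℝ := rlRight μ 1 (fun η => u (z.1, η)) z.2

/-- The constant `C_α = 1 / (2 cos (α π / 2))`. -/
def rieszConst (α : ℝ) : ℝ := 1 / (2 * Real.cos (α * Real.pi / 2))

/-- The bilinear form `a(u, v) = (u, v)_w`; `‖u‖_w²` is `wForm α β u u`. -/
def wForm (α β : ℝ) (u v : ℝ × ℝ → ℝ) : ℝ :=
  rieszConst α * ip (dxLeft (α / 2) u) (dxRight (α / 2) v)
    + rieszConst α * ip (dxRight (α / 2) u) (dxLeft (α / 2) v)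
    + rieszConst β * ip (dyLeft (β / 2) u) (dyRight (β / 2) v)
    + rieszConst β * ip (dyRight (β / 2) u) (dyLeft (β / 2) v)

/-! ### The spaces `H₀^μ(Ω)` -/

/-- The plane with its Euclidean structure (where Fourier transforms are taken). -/
abbrev Plane : Type := EuclideanSpace ℝ (Fin 2)

/-- The square of the norm of `H^μ(ℝ²)`, i.e. `‖w‖² + ‖ |ω|^μ ŵ ‖²`; it is finite exactly
when `w` belongs to `H^μ(ℝ²)`. -/
def sobolevSq (μ : ℝ) (w : Lp ℂ 2 (volume : Measure Plane)) : ℝ≥0∞ :=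
  ∫⁻ y : Plane, ENNReal.ofReal (1 + (2 * Real.pi * ‖y‖) ^ (2 * μ)) * ‖(𝓕 w) y‖ₑ ^ 2

/-- `Ω` as a subset of the Euclidean plane. -/
def OmegaE : Set Plane := {x | (x 0, x 1) ∈ Omega}

/-- `v` restricted to `Ω` is the restriction of some `w` in `H^μ(ℝ²)` with `‖w‖² ≤ r` (the
squared norm of `H^μ(Ω)` is the infimum of such `r`). -/
def HasExtension (μ : ℝ) (v : ℝ × ℝ → ℝ) (r : ℝ≥0∞) : Prop :=
  ∃ w : Lp ℂ 2 (volume : Measure Plane),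
    (∀ᵐ x ∂(volume.restrict OmegaE), w x = ((v (x 0, x 1) : ℝ) : ℂ)) ∧ sobolevSq μ w ≤ r

/-- Membership in `H₀^μ(Ω)`: the closure of `C_c^∞(Ω)` in the norm of `H^μ(Ω)`. -/
def MemH0 (μ : ℝ) (v : ℝ × ℝ → ℝ) : Prop :=
  ∀ ε : ℝ, 0 < ε → ∃ φ : ℝ × ℝ → ℝ, ContDiff ℝ ∞ φ ∧ HasCompactSupport φ ∧ tsupport φ ⊆ Omega ∧
    HasExtension μ (v - φ) (ENNReal.ofReal ε)

/-! ### Finite element space -/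

/-- A (conforming, finite) triangulation of `Ω`.  The elements `K` are the convex hulls of the
faces with three vertices. -/
structure IsTriangulation (𝒯 : Geometry.SimplicialComplex ℝ (ℝ × ℝ)) : Prop where
  finite : 𝒯.faces.Finite
  space_eq : 𝒯.space = Icc (0 : ℝ) 1 ×ˢ Icc (0 : ℝ) 1

/-- The finite element space `X_h ⊆ H₀^{α/2}(Ω) ∩ H₀^{β/2}(Ω) ∩ C⁰` of piecewise polynomials of
degree at most `m`.  Its elements are functions on the whole plane satisfying the exterior
condition `v = 0` off `Ω`. -/
def feSpace (α β : ℝ) (𝒯 : Geometry.SimplicialComplex ℝ (ℝ × ℝ)) (m : ℕ) : Set (ℝ × ℝ → ℝ) :=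
  {v | Continuous v ∧ (∀ z, z ∉ Omega → v z = 0) ∧ MemH0 (α / 2) v ∧ MemH0 (β / 2) v ∧
    ∀ s ∈ 𝒯.faces, s.card = 3 → ∃ p : MvPolynomial (Fin 2) ℝ, p.totalDegree ≤ m ∧
      ∀ z ∈ convexHull ℝ (s : Set (ℝ × ℝ)), v z = MvPolynomial.eval ![z.1, z.2] p}

/-- The time step `τ = T / N`. -/
def step (T : ℝ) (N : ℕ) : ℝ := T / N

/-- The backward Euler Galerkin scheme in a space `X` (a set of functions), with source `f`
(`f t` is a function on the plane), for time levels `1, …, N`. -/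
def IsEulerGalerkin (α β T : ℝ) (N : ℕ) (f : ℝ → ℝ × ℝ → ℝ) (X : Set (ℝ × ℝ → ℝ))
    (u : ℕ → ℝ × ℝ → ℝ) : Prop :=
  (∀ n ≤ N, u n ∈ X) ∧
    ∀ n, n + 1 ≤ N → ∀ v ∈ X,
      ip (u (n + 1)) v + step T N * wForm α β (u (n + 1)) v
        = step T N * ip (f ((n + 1 : ℕ) * step T N)) v + ip (u n) v

/-! ### Proper orthogonal decomposition -/

/-- The correlation matrix `G_{ij} = (U_i, U_j)_w / L` of the snapshots. -/
def corrMatrix (α β : ℝ) {L : ℕ} (U : Fin L → ℝ × ℝ → ℝ) : Matrix (Fin L) (Fin L) ℝ :=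
  Matrix.of fun i j => 1 / (L : ℝ) * wForm α β (U i) (U j)

/-- `lam k`, `a k` (`k < l`, where `l` is the dimension of the span of the snapshots) are the
positive eigenvalues of the correlation matrix in decreasing order, with orthonormal
eigenvectors. -/
structure IsPODSystem (α β : ℝ) {L : ℕ} (U : Fin L → ℝ × ℝ → ℝ) (l : ℕ)
    (lam : Fin l → ℝ) (a : Fin l → Fin L → ℝ) : Prop where
  dim_eq : l = Module.finrank ℝ (Submodule.span ℝ (Set.range U))
  pos : ∀ k, 0 < lam k
  anti : Antitone lam
  eigen : ∀ k, (corrMatrix α β U).mulVec (a k) = lam k • a k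
  orthonormal : ∀ k k', ∑ i, a k i * a k' i = if k = k' then 1 else 0

/-- The POD basis element `ψ_k = (L λ_k)^{-1/2} ∑ i, a_i^k U_i`. -/
def podMode {L : ℕ} (U : Fin L → ℝ × ℝ → ℝ) {l : ℕ} (lam : Fin l → ℝ)
    (a : Fin l → Fin L → ℝ) (k : Fin l) : ℝ × ℝ → ℝ :=
  (1 / Real.sqrt (L * lam k)) • ∑ i, a k i • U i

/-- The reduced space `W^d`, spanned by the first `d` POD basis elements. -/
def podSpace {L : ℕ} (U : Fin L → ℝ × ℝ → ℝ) {l : ℕ} (lam : Fin l → ℝ)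
    (a : Fin l → Fin L → ℝ) (d : ℕ) : Submodule ℝ (ℝ × ℝ → ℝ) :=
  Submodule.span ℝ (podMode U lam a '' {k | (k : ℕ) < d})

/-- The tail `∑_{j = d+1}^{l} λ_j` (the indices of `Fin l` start at `0`). -/
def tailSum {l : ℕ} (lam : Fin l → ℝ) (d : ℕ) : ℝ :=
  ∑ k : Fin l, if d ≤ (k : ℕ) then lam k else 0

/-- `p` is the projection `P^d u` of `u` on `W` with respect to `a(·,·)`. -/
def IsRitzProj (α β : ℝ) (W : Submodule ℝ (ℝ × ℝ → ℝ)) (u p : ℝ × ℝ → ℝ) : Prop :=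
  p ∈ W ∧ ∀ v ∈ W, wForm α β p v = wForm α β u v

/-- One run of the method: a triangulation, the source `f`, the finite element solution `u`,
`L` snapshots `u (ν i)` with `1 ≤ ν 0 ≤ … ≤ ν (L-1) ≤ N`, a POD basis of them, and the solution
`ud` of the reduced scheme in `W^d`, `1 ≤ d ≤ l`. -/
structure IsRun (α β T : ℝ) (𝒯 : Geometry.SimplicialComplex ℝ (ℝ × ℝ)) (m : ℕ)
    (f : ℝ → ℝ × ℝ → ℝ) (N : ℕ) (u : ℕ → ℝ × ℝ → ℝ) {L : ℕ} (ν : Fin L → ℕ) {l : ℕ}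
    (lam : Fin l → ℝ) (a : Fin l → Fin L → ℝ) (d : ℕ) (ud : ℕ → ℝ × ℝ → ℝ) : Prop where
  triangulation : IsTriangulation 𝒯
  one_le_degree : 1 ≤ m
  source : ∀ t ∈ Icc (0 : ℝ) T, MemLp (f t) 2 (volume.restrict Omega)
  one_le_steps : 1 ≤ N
  fe : IsEulerGalerkin α β T N f (feSpace α β 𝒯 m) u
  mono : Monotone ν
  range : ∀ i, 1 ≤ ν i ∧ ν i ≤ N
  pod : IsPODSystem α β (fun i => u (ν i)) l lam a
  one_le_d : 1 ≤ d
  d_le : d ≤ l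
  reduced : IsEulerGalerkin α β T N f (podSpace (fun i => u (ν i)) lam a d) ud
  initial : IsRitzProj α β (podSpace (fun i => u (ν i)) lam a d) (u 0) (ud 0)

/-- The snapshots are taken at uniform intervals from the whole range `1, …, N`: they are all
the time levels in that range of the form `r + i s`, with first level `r ≤ s`. -/
def IsUniform (N : ℕ) {L : ℕ} (ν : Fin L → ℕ) : Prop :=
  ∃ r s : ℕ, 1 ≤ r ∧ r ≤ s ∧ (∀ i, ν i = r + i * s) ∧ N < r + L * s

end RieszPOD

end

open RieszPOD

/-!
# Stability and error of the POD reduced scheme for a Riesz fractional diffusion equation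

Elements of the finite element space are Lipschitz functions vanishing off `Ω`, because a continuous
function that is Lipschitz on each of finitely many closed sets covering the plane (the triangles
and the complement of `Ω`) is Lipschitz. On the space `lipSpace` of such functions the energy form is
bilinear, symmetric and coercive over `L²`; coercivity is `exists_coercive_rl`, in one variable. For
a Lipschitz `g` vanishing off `(0,1)` and `μ = α/2`, the Riemann-Liouville derivatives are
convolutions of `g'` with `t ^ (-μ)`, so that by Fubini and the beta integral
`2 ∫ (D_left g) (D_right g) = -C ∬ g'(ξ) g'(η) |ξ - η| ^ (1 - α) dξ dη` with `C > 0`. The Riesz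
kernel is in turn a superposition of products of indicators of intervals,
`|ξ - η| ^ (1 - α) = α (α - 1) ∬ 1[p < ξ < q] 1[p < η < q] (q - p) ^ (-α - 1) dp dq`,
which turns the double integral into a multiple of
`∬ (g q - g p) ^ 2 (q - p) ^ (-α - 1) dp dq`. It is nonnegative, and the part over `p ∈ (0,1)`,
`q ∈ (1,2)`, where `g q = 0`, dominates a multiple of `∫ g ^ 2`. Since both `rieszConst α` and
`rieszConst β` are negative, the energy form is an inner product on `lipSpace` controlling `L²`.

The rest takes place in an inner product space `E` (the energy space) with a linear map `ι` to an
inner product space `H` (which is `L²(Ω)`).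

* Stability: testing with the solution gives `‖ι uⁿ‖ ≤ ‖ι u⁰‖ + τ ∑ ‖fⁱ‖`, and the summed energy
  identity together with Young's and the Cauchy-Schwarz inequality gives the claim.
* Error: let `P` be the energy projection onto the reduced space `W` and `ρⁿ = uⁿ - P uⁿ`. The
  part of the error in `W` solves the scheme with the right-hand side `-(ρⁿ - ρⁿ⁻¹)` and starts
  from `0`, so the error at level `n` is at most a multiple of `‖ρⁿ‖ + ∑ ‖ρʲ⁺¹ - ρʲ‖`
  (`IsEulerScheme.norm_sub_galerkin_le`).
* The POD identity bounds `∑ ‖ρ‖ ^ 2` over the snapshots by `L` times the tail of the eigenvalues,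
  hence `∑ ‖ρ‖` by `L` times its square root. Between consecutive snapshots, which are a bounded
  number of steps apart, an increment of `ρ` differs from the mean increment by second differences,
  and these are `O(τ²)`. The bounded number of steps outside contribute `O(τ)` through first
  differences (`sum_norm_diff_uniform_le`).
* For fixed data, the finite element space is finite-dimensional, so the energy norm is bounded by
  the `L²` norm there; testing the differenced scheme with first and second differences bounds
  these by `O(τ)` and `O(τ²)` (`IsEulerScheme.diff_le`).
-/

namespace RieszPOD

open scoped NNReal Topology

/-! ### The backward Euler scheme in an inner product space -/

section

open scoped InnerProductSpace

variable {E H : Type*} [NormedAddCommGroup E] [InnerProductSpace ℝ E]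
  [NormedAddCommGroup H] [InnerProductSpace ℝ H]

/-- The backward Euler Galerkin scheme with `N` steps of length `τ` in the subspace `W` of the
energy space `E`; the `L²` products are those of `H`, pulled back along `ι`, and `F n` is the source at
level `n`. Nothing is required of `u n` for `n > N`. -/
structure IsEulerScheme (ι : E →ₗ[ℝ] H) (τ : ℝ) (N : ℕ) (F : ℕ → H) (W : Submodule ℝ E)
    (u : ℕ → E) : Prop where
  mem : ∀ n ≤ N, u n ∈ W
  eq : ∀ n < N, ∀ v ∈ W, ⟪ι (u (n + 1)), ι v⟫_ℝ + τ * ⟪u (n + 1), v⟫_ℝ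
    = τ * ⟪F (n + 1), ι v⟫_ℝ + ⟪ι (u n), ι v⟫_ℝ

/-- One implicit step is a contraction of the `L²` norm: the energy term has a good sign. -/
theorem norm_le_of_euler_step {ι : E →ₗ[ℝ] H} {τ : ℝ} (hτ : 0 ≤ τ) {w : E} {g : H}
    (h : ⟪ι w, ι w⟫_ℝ + τ * ⟪w, w⟫_ℝ = ⟪g, ι w⟫_ℝ) : ‖ι w‖ ≤ ‖g‖ := by
  rw [real_inner_self_eq_norm_sq, real_inner_self_eq_norm_sq] at h
  have h1 := real_inner_le_norm g (ι w)
  have h2 : 0 ≤ τ * ‖w‖ ^ 2 := by positivity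
  by_contra! hlt
  have := norm_nonneg g
  nlinarith

variable {ι : E →ₗ[ℝ] H} {τ : ℝ} {N : ℕ} {F : ℕ → H} {W : Submodule ℝ E} {u : ℕ → E}

theorem IsEulerScheme.norm_succ_le (h : IsEulerScheme ι τ N F W u) (hτ : 0 ≤ τ) {n : ℕ}
    (hn : n < N) : ‖ι (u (n + 1))‖ ≤ ‖ι (u n)‖ + τ * ‖F (n + 1)‖ := by
  have h1 := h.eq n hn _ (h.mem (n + 1) hn)
  have h2 : ‖ι (u (n + 1))‖ ≤ ‖τ • F (n + 1) + ι (u n)‖ :=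
    norm_le_of_euler_step hτ (by rw [h1, inner_add_left, real_inner_smul_left])
  refine h2.trans ((norm_add_le _ _).trans ?_)
  rw [norm_smul, Real.norm_of_nonneg hτ, add_comm]

theorem IsEulerScheme.norm_le (h : IsEulerScheme ι τ N F W u) (hτ : 0 ≤ τ) {n : ℕ}
    (hn : n ≤ N) : ‖ι (u n)‖ ≤ ‖ι (u 0)‖ + τ * ∑ i ∈ Finset.Icc 1 n, ‖F i‖ := by
  induction n with
  | zero => simp
  | succ n ih =>
    rw [Finset.sum_Icc_succ_top (by omega), mul_add]
    linarith [h.norm_succ_le hτ (n := n) (by omega), ih (by omega)]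

/-- The discrete energy inequality, from testing every step with its own solution. -/
theorem IsEulerScheme.energy_le (h : IsEulerScheme ι τ N F W u) {n : ℕ}
    (hn : n ≤ N) : ‖ι (u n)‖ ^ 2 + 2 * τ * ∑ i ∈ Finset.Icc 1 n, ‖u i‖ ^ 2
      ≤ ‖ι (u 0)‖ ^ 2 + 2 * τ * ∑ i ∈ Finset.Icc 1 n, ⟪F i, ι (u i)⟫_ℝ := by
  induction n with
  | zero => simp
  | succ n ih =>
    rw [Finset.sum_Icc_succ_top (by omega), Finset.sum_Icc_succ_top (by omega)]
    have h1 := h.eq n hn _ (h.mem (n + 1) hn)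
    have h2 := real_inner_le_norm (ι (u n)) (ι (u (n + 1)))
    rw [real_inner_self_eq_norm_sq, real_inner_self_eq_norm_sq] at h1
    have h3 := ih (by omega)
    nlinarith [sq_nonneg (‖ι (u n)‖ - ‖ι (u (n + 1))‖)]

/-- Unconditional stability. No coercivity enters, only that the energy is nonnegative, so that the
constant is independent of the orders of the derivatives. -/
theorem IsEulerScheme.stability (h : IsEulerScheme ι τ N F W u) (hτ : 0 ≤ τ) {T ε : ℝ}
    (hT : N * τ = T) (hε : 0 < ε) {n : ℕ} (hn : n ≤ N) :
    ‖ι (u n)‖ ^ 2 + 2 * τ * ∑ i ∈ Finset.Icc 1 n, ‖u i‖ ^ 2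
      ≤ (1 / ε + 2) * T * τ * ∑ i ∈ Finset.Icc 1 n, ‖F i‖ ^ 2 + (1 + ε) * ‖ι (u 0)‖ ^ 2 := by
  set S := ∑ i ∈ Finset.Icc 1 n, ‖F i‖ with hS
  set Q := ∑ i ∈ Finset.Icc 1 n, ‖F i‖ ^ 2 with hQ
  set A := ‖ι (u 0)‖
  have hS0 : 0 ≤ S := Finset.sum_nonneg fun i _ => norm_nonneg (F i)
  have hQ0 : 0 ≤ Q := Finset.sum_nonneg fun _ _ => by positivity
  have hA0 : 0 ≤ A := norm_nonneg _
  have h1 : ∑ i ∈ Finset.Icc 1 n, ⟪F i, ι (u i)⟫_ℝ ≤ S * (A + τ * S) := by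
    rw [hS, Finset.sum_mul]
    refine Finset.sum_le_sum fun i hi => (real_inner_le_norm _ _).trans ?_
    rw [Finset.mem_Icc] at hi
    refine mul_le_mul_of_nonneg_left ((h.norm_le hτ (hi.2.trans hn)).trans ?_) (norm_nonneg _)
    gcongr
    exact hi.2
  have h2 : (τ * S) ^ 2 ≤ T * τ * Q := by
    have h3 : S ^ 2 ≤ n * Q := by
      have := sq_sum_le_card_mul_sum_sq (s := Finset.Icc 1 n) (f := fun i => ‖F i‖)
      simpa using this
    have h4 : (n : ℝ) * Q ≤ N * Q := by gcongr
    calc (τ * S) ^ 2 = τ ^ 2 * S ^ 2 := by ring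
      _ ≤ τ ^ 2 * (N * Q) := by gcongr; exact h3.trans h4
      _ = T * τ * Q := by rw [← hT]; ring
  have h5 := h.energy_le hn
  have h6 : 2 * A * (τ * S) ≤ ε * A ^ 2 + 1 / ε * (τ * S) ^ 2 := by
    have h7 : 0 ≤ (1 / ε) * (ε * A - τ * S) ^ 2 := by positivity
    have h8 : (1 / ε) * (ε * A - τ * S) ^ 2
        = ε * A ^ 2 + 1 / ε * (τ * S) ^ 2 - 2 * A * (τ * S) := by
      field_simp
      ring
    linarith
  have h9 : (1 / ε + 2) * (τ * S) ^ 2 ≤ (1 / ε + 2) * (T * τ * Q) := by gcongr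
  have h10 := mul_le_mul_of_nonneg_left h1 (by positivity : 0 ≤ 2 * τ)
  nlinarith

/-- The distance between the Galerkin solutions in `X` and in a smaller space `W`, in terms of the
energy projections of the former onto the orthogonal complement of `W`. The component of the
difference in `W` is propagated by the scheme, with the increments of these projections as source,
and vanishes at level `0`. -/
theorem IsEulerScheme.norm_sub_galerkin_le {X : Submodule ℝ E} {ud : ℕ → E}
    [W.HasOrthogonalProjection]
    (hu : IsEulerScheme ι τ N F X u) (hd : IsEulerScheme ι τ N F W ud) (hWX : W ≤ X)
    (hτ : 0 ≤ τ) (h0 : ∀ v ∈ W, ⟪ud 0, v⟫_ℝ = ⟪u 0, v⟫_ℝ) {C : ℝ} (hC : ∀ v, ‖ι v‖ ≤ C * ‖v‖)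
    {n : ℕ} (hn : n ≤ N) :
    ‖ι (u n - ud n)‖ ≤ C * (‖Wᗮ.starProjection (u n)‖
      + ∑ j ∈ Finset.range n, ‖Wᗮ.starProjection (u (j + 1)) - Wᗮ.starProjection (u j)‖) := by
  have hsplit : ∀ x : E, x = W.starProjection x + Wᗮ.starProjection x := fun x => by
    rw [W.starProjection_add_starProjection_orthogonal]
  have hθ : ∀ m ≤ N, ‖ι (W.starProjection (u m) - ud m)‖ ≤ C * ∑ j ∈ Finset.range m,
      ‖Wᗮ.starProjection (u (j + 1)) - Wᗮ.starProjection (u j)‖ := by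
    intro m
    induction m with
    | zero =>
      intro _
      have : W.starProjection (u 0) = ud 0 :=
        Submodule.eq_starProjection_of_mem_of_inner_eq_zero (hd.mem 0 (Nat.zero_le _))
          fun v hv => by rw [inner_sub_left, h0 v hv, sub_self]
      simp [this]
    | succ m ih =>
      intro hm
      have ih := ih (by omega)
      set w := W.starProjection (u (m + 1)) - ud (m + 1) with hw
      have hwW : w ∈ W := W.sub_mem (Submodule.starProjection_apply_mem _ _) (hd.mem _ hm)
      have e1 := hu.eq m hm w (hWX hwW)
      have e2 := hd.eq m hm w hwW
      -- the energy product does not see the component of `u (m + 1)` orthogonal to `W`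
      have ho : ⟪Wᗮ.starProjection (u (m + 1)), w⟫_ℝ = 0 :=
        Submodule.inner_left_of_mem_orthogonal hwW (Submodule.starProjection_apply_mem _ _)
      have key : ⟪ι w, ι w⟫_ℝ + τ * ⟪w, w⟫_ℝ
          = ⟪ι (W.starProjection (u m) - ud m)
            - ι (Wᗮ.starProjection (u (m + 1)) - Wᗮ.starProjection (u m)), ι w⟫_ℝ := by
        have a1 : w = u (m + 1) - Wᗮ.starProjection (u (m + 1)) - ud (m + 1) := by
          rw [hw]; nth_rewrite 2 [hsplit (u (m + 1))]; abel
        have a2 : W.starProjection (u m) = u m - Wᗮ.starProjection (u m) := by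
          nth_rewrite 2 [hsplit (u m)]; abel
        have b1 : ⟪ι w, ι w⟫_ℝ = ⟪ι (u (m + 1)), ι w⟫_ℝ
            - ⟪ι (Wᗮ.starProjection (u (m + 1))), ι w⟫_ℝ - ⟪ι (ud (m + 1)), ι w⟫_ℝ := by
          rw [← inner_sub_left, ← inner_sub_left, ← map_sub, ← map_sub, ← a1]
        have b2 : ⟪w, w⟫_ℝ = ⟪u (m + 1), w⟫_ℝ
            - ⟪Wᗮ.starProjection (u (m + 1)), w⟫_ℝ - ⟪ud (m + 1), w⟫_ℝ := by
          rw [← inner_sub_left, ← inner_sub_left, ← a1]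
        rw [b1, b2, ho, a2]
        simp only [map_sub, inner_sub_left]
        linarith
      have h1 := norm_le_of_euler_step hτ key
      rw [Finset.sum_range_succ, mul_add]
      exact h1.trans ((norm_sub_le _ _).trans (add_le_add ih (hC _)))
  have e : ι (u n - ud n) = ι (W.starProjection (u n) - ud n) + ι (Wᗮ.starProjection (u n)) := by
    rw [← map_add]; congr 1; nth_rewrite 1 [hsplit (u n)]; abel
  rw [e, mul_add, add_comm (C * _)]
  exact (norm_add_le _ _).trans (add_le_add (hθ n hn) (hC _))

/-! ### Increments between uniform samples -/

/-- Within a block of `s` steps every increment is the mean increment up to `s` second differences,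
so the total variation is the length of the total increment, up to second differences. -/
theorem sum_norm_diff_block_le {y : ℕ → E} {s : ℕ} {δ : ℝ} (hδ : 0 ≤ δ)
    (h2 : ∀ k, k + 2 ≤ s → ‖y (k + 2) - (2 : ℕ) • y (k + 1) + y k‖ ≤ δ) :
    ∑ k ∈ Finset.range s, ‖y (k + 1) - y k‖ ≤ ‖y s‖ + ‖y 0‖ + s * (s * δ) := by
  set D : ℕ → E := fun k => y (k + 1) - y k with hD
  have hDD : ∀ j m, j + m < s → ‖D (j + m) - D j‖ ≤ m * δ := by
    intro j m
    induction m with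
    | zero => intro _; simp
    | succ m ih =>
      intro hm
      have h3 := h2 (j + m) (by omega)
      have h4 : D (j + (m + 1)) - D j
          = (y (j + m + 2) - (2 : ℕ) • y (j + m + 1) + y (j + m)) + (D (j + m) - D j) := by
        simp only [hD, ← add_assoc]; rw [two_nsmul]; abel
      rw [h4]
      push_cast
      linarith [norm_add_le (y (j + m + 2) - (2 : ℕ) • y (j + m + 1) + y (j + m))
        (D (j + m) - D j), ih (by omega)]
  have hle : ∀ a b, a ≤ b → b < s → ‖D b - D a‖ ≤ s * δ := by
    intro a b hab hb
    obtain ⟨m, rfl⟩ := Nat.exists_eq_add_of_le hab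
    refine (hDD a m hb).trans ?_
    gcongr
    omega
  have hDD' : ∀ j k, j < s → k < s → ‖D k - D j‖ ≤ s * δ := by
    intro j k hj hk
    rcases le_total j k with h | h
    · exact hle j k h hk
    · rw [norm_sub_rev]; exact hle k j h hj
  rcases Nat.eq_zero_or_pos s with rfl | hs
  · simp
  have hs' : (0 : ℝ) < s := by exact_mod_cast hs
  have hk : ∀ k ∈ Finset.range s, ‖D k‖ ≤ (‖y s‖ + ‖y 0‖ + s * (s * δ)) / s := by
    intro k hk
    rw [Finset.mem_range] at hk
    have e : (s : ℝ) • D k = (y s - y 0) + ∑ j ∈ Finset.range s, (D k - D j) := by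
      rw [Finset.sum_sub_distrib, Finset.sum_range_sub, Finset.sum_const, Finset.card_range,
        Nat.cast_smul_eq_nsmul]
      abel
    rw [le_div_iff₀ hs', mul_comm]
    calc (s : ℝ) * ‖D k‖ = ‖(s : ℝ) • D k‖ := by rw [norm_smul, Real.norm_of_nonneg hs'.le]
      _ ≤ ‖y s - y 0‖ + ‖∑ j ∈ Finset.range s, (D k - D j)‖ := by rw [e]; exact norm_add_le _ _
      _ ≤ (‖y s‖ + ‖y 0‖) + ∑ j ∈ Finset.range s, s * δ := by
        refine add_le_add (norm_sub_le _ _) ((norm_sum_le _ _).trans ?_)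
        exact Finset.sum_le_sum fun j hj => hDD' j k (Finset.mem_range.1 hj) hk
      _ = _ := by simp
  refine (Finset.sum_le_sum hk).trans (le_of_eq ?_)
  rw [Finset.sum_const, Finset.card_range, nsmul_eq_mul]
  field_simp

/-- The total variation of a sequence sampled at all levels `r + i s ≤ N` with `1 ≤ r ≤ s`, in terms
of the samples and of bounds for its first and second differences. Since `N ≤ σ L`, either `L = 1`
and there are at most `σ` steps in all, or `s ≤ 2 σ`. -/
theorem sum_norm_diff_uniform_le {y : ℕ → E} {N L r s : ℕ} (hr : 1 ≤ r) (hrs : r ≤ s)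
    (hL : 1 ≤ L) (hN : r + (L - 1) * s ≤ N) (hN' : N < r + L * s) {σ : ℝ} (hσ : (N : ℝ) ≤ σ * L)
    {δ₁ δ₂ : ℝ} (hδ₁ : 0 ≤ δ₁) (hδ₂ : 0 ≤ δ₂)
    (h1 : ∀ n, n + 1 ≤ N → ‖y (n + 1) - y n‖ ≤ δ₁)
    (h2 : ∀ n, n + 2 ≤ N → ‖y (n + 2) - (2 : ℕ) • y (n + 1) + y n‖ ≤ δ₂) :
    ∑ j ∈ Finset.range N, ‖y (j + 1) - y j‖
      ≤ 2 * ∑ i ∈ Finset.range L, ‖y (r + i * s)‖ + 4 * σ * δ₁ + 2 * σ * N * δ₂ := by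
  obtain ⟨p, rfl⟩ : ∃ p, L = p + 1 := ⟨L - 1, by omega⟩
  simp only [Nat.add_sub_cancel] at hN
  set f : ℕ → ℝ := fun j => ‖y (j + 1) - y j‖ with hf
  set R : ℕ → ℝ := fun i => ‖y (r + i * s)‖ with hR
  have hblock : ∀ i ≤ p, ∑ j ∈ Finset.range (r + i * s), f j
      ≤ r * δ₁ + ∑ k ∈ Finset.range i, (R (k + 1) + R k) + i * (s * (s * δ₂)) := by
    intro i
    induction i with
    | zero =>
      intro _
      have : ∑ j ∈ Finset.range r, f j ≤ ∑ j ∈ Finset.range r, δ₁ :=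
        Finset.sum_le_sum fun j hj => h1 j (by
          rw [Finset.mem_range] at hj
          have := Nat.zero_le (p * s)
          omega)
      simpa using this
    | succ i ih =>
      intro hi
      have ih := ih (by omega)
      have hle : r + i * s + s ≤ N := by
        have : (i + 1) * s ≤ p * s := Nat.mul_le_mul_right _ hi
        rw [Nat.add_mul] at this
        omega
      have hb := sum_norm_diff_block_le (y := fun k => y (r + i * s + k)) (s := s) hδ₂
        fun k hk => h2 (r + i * s + k) (by omega)
      rw [show r + (i + 1) * s = r + i * s + s by ring, Finset.sum_range_add,
        Finset.sum_range_succ _ i]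
      have hb' : ∑ k ∈ Finset.range s, f (r + i * s + k) ≤ R (i + 1) + R i + s * (s * δ₂) := by
        simp only [hR, hf, show r + (i + 1) * s = r + i * s + s by ring]
        exact hb
      push_cast
      linarith
  have htail : ∑ j ∈ Finset.range N, f j
      ≤ ∑ j ∈ Finset.range (r + p * s), f j + (N - (r + p * s) : ℕ) * δ₁ := by
    rw [← Nat.add_sub_of_le hN, Finset.sum_range_add, Nat.add_sub_of_le hN]
    gcongr
    rw [← nsmul_eq_mul, ← Finset.card_range (N - (r + p * s)), ← Finset.sum_const,
      Finset.card_range]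
    exact Finset.sum_le_sum fun j hj => h1 _ (by
      rw [Finset.mem_range] at hj
      omega)
  have hRsum : ∑ k ∈ Finset.range p, (R (k + 1) + R k) ≤ 2 * ∑ i ∈ Finset.range (p + 1), R i := by
    rw [Finset.sum_add_distrib, two_mul]
    refine add_le_add ?_ ?_
    · rw [Finset.sum_range_succ' R]
      linarith [norm_nonneg (y (r + 0 * s))]
    · rw [Finset.sum_range_succ R]
      linarith [norm_nonneg (y (r + p * s))]
  have hNs : (N : ℝ) < r + (p + 1) * s := by exact_mod_cast hN'
  have hNs' : (r : ℝ) + p * s ≤ N := by exact_mod_cast hN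
  have hr' : (1 : ℝ) ≤ r := by exact_mod_cast hr
  have hrs' : (r : ℝ) ≤ s := by exact_mod_cast hrs
  push_cast at hσ
  have hσ0 : 0 ≤ σ := by
    by_contra! h
    nlinarith [(Nat.cast_nonneg p : (0 : ℝ) ≤ p), (Nat.cast_nonneg N : (0 : ℝ) ≤ N)]
  -- at most `4 σ` steps lie before the first or after the last sample
  have hcount : (r : ℝ) + (N - (r + p * s) : ℕ) ≤ 4 * σ ∧ (p : ℝ) * (s * s) ≤ 2 * σ * N := by
    rw [Nat.cast_sub hN]
    push_cast
    rcases Nat.eq_zero_or_pos p with hp | hp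
    · subst hp
      simp only [Nat.cast_zero, zero_mul, zero_add, mul_one, add_zero] at hσ ⊢
      exact ⟨by linarith, by positivity⟩
    · have hp' : (1 : ℝ) ≤ p := by exact_mod_cast hp
      have hs2 : (s : ℝ) ≤ 2 * σ := by
        have : (p : ℝ) * s ≤ p * (2 * σ) := by nlinarith
        exact le_of_mul_le_mul_left this (by linarith)
      refine ⟨by linarith, ?_⟩
      have : (p : ℝ) * s ≤ N := by linarith
      nlinarith [mul_le_mul hs2 this (by positivity) (by positivity)]
  have hb := hblock p le_rfl
  have e1 := mul_le_mul_of_nonneg_right hcount.1 hδ₁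
  have e2 := mul_le_mul_of_nonneg_right hcount.2 hδ₂
  nlinarith

theorem norm_le_norm_add_sum_diff {G : Type*} [SeminormedAddCommGroup G] (y : ℕ → G)
    {N n r : ℕ} (hn : n ≤ N) (hr : r ≤ N) :
    ‖y n‖ ≤ ‖y r‖ + ∑ j ∈ Finset.range N, ‖y (j + 1) - y j‖ := by
  have key : ∀ a b, a ≤ b → b ≤ N → ‖y b - y a‖ ≤ ∑ j ∈ Finset.range N, ‖y (j + 1) - y j‖ := by
    intro a b hab hb
    rw [← Finset.sum_Ico_sub y hab]
    refine (norm_sum_le _ _).trans (Finset.sum_le_sum_of_subset_of_nonneg ?_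
      fun _ _ _ => norm_nonneg _)
    intro j hj
    rw [Finset.mem_Ico] at hj
    exact Finset.mem_range.2 (by omega)
  have h1 : ‖y n - y r‖ ≤ ∑ j ∈ Finset.range N, ‖y (j + 1) - y j‖ := by
    rcases le_total r n with h | h
    · exact key r n h hn
    · rw [norm_sub_rev]; exact key n r h hr
  have := norm_add_le (y r) (y n - y r)
  rw [add_sub_cancel] at this
  linarith

/-! ### Proper orthogonal decomposition -/

/-- The projection error of the snapshots on the span of the first `d` modes is governed by the
discarded eigenvalues: the modes are an orthonormal basis of the span of the snapshots, and the
coefficient of the mode `k` in `U i` is `√(L λ_k) a_k i`. -/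
theorem pod_sum_sq_le {L l : ℕ} (hL : 1 ≤ L) (U : Fin L → E) (lam : Fin l → ℝ)
    (a : Fin l → Fin L → ℝ) (hdim : l = Module.finrank ℝ (Submodule.span ℝ (Set.range U)))
    (hpos : ∀ k, 0 < lam k)
    (heig : ∀ k i, ∑ j, 1 / (L : ℝ) * ⟪U i, U j⟫_ℝ * a k j = lam k * a k i)
    (hort : ∀ k k', ∑ i, a k i * a k' i = if k = k' then 1 else 0)
    (W : Submodule ℝ E) [W.HasOrthogonalProjection] (d : ℕ)
    (hW : W = Submodule.span ℝ
      ((fun k => (1 / Real.sqrt (L * lam k)) • ∑ i, a k i • U i) '' {k : Fin l | (k : ℕ) < d})) :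
    ∑ i, ‖Wᗮ.starProjection (U i)‖ ^ 2 ≤ L * tailSum lam d := by
  set ψ : Fin l → E := fun k => (1 / Real.sqrt (L * lam k)) • ∑ i, a k i • U i with hψ
  have hL0 : (0 : ℝ) < L := by exact_mod_cast hL
  have hsq : ∀ k, Real.sqrt (L * lam k) ^ 2 = L * lam k := fun k =>
    Real.sq_sqrt (mul_pos hL0 (hpos k)).le
  have hsp : ∀ k, 0 < Real.sqrt (L * lam k) := fun k => Real.sqrt_pos.2 (mul_pos hL0 (hpos k))
  have hin : ∀ k i, ⟪ψ k, U i⟫_ℝ = Real.sqrt (L * lam k) * a k i := by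
    intro k i
    have h1 : ∑ j, a k j * ⟪U j, U i⟫_ℝ = L * lam k * a k i := by
      rw [mul_assoc, ← heig k i, Finset.mul_sum]
      refine Finset.sum_congr rfl fun j _ => ?_
      rw [real_inner_comm]
      field_simp
    rw [hψ]
    simp only [real_inner_smul_left, sum_inner]
    rw [h1, one_div_mul_eq_div, div_eq_iff (hsp k).ne']
    linear_combination -(a k i) * hsq k
  have horth : Orthonormal ℝ ψ := by
    rw [orthonormal_iff_ite]
    intro k k'
    have e : ⟪ψ k, ψ k'⟫_ℝ = (1 / Real.sqrt (L * lam k')) * ∑ i, a k' i * ⟪ψ k, U i⟫_ℝ := by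
      conv_lhs => rw [hψ]
      simp only [real_inner_smul_right, inner_sum]
      rfl
    rw [e]
    simp only [hin]
    have e2 : ∑ i, a k' i * (Real.sqrt (L * lam k) * a k i)
        = Real.sqrt (L * lam k) * if k = k' then 1 else 0 := by
      rw [← hort k k', Finset.mul_sum]
      exact Finset.sum_congr rfl fun i _ => by ring
    rw [e2]
    split_ifs with h
    · subst h; have := (hsp k).ne'; field_simp
    · simp
  have hspan : Submodule.span ℝ (Set.range ψ) = Submodule.span ℝ (Set.range U) := by
    have : FiniteDimensional ℝ (Submodule.span ℝ (Set.range U)) :=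
      FiniteDimensional.span_of_finite ℝ (Set.finite_range U)
    refine Submodule.eq_of_le_of_finrank_eq ?_ ?_
    · rw [Submodule.span_le]
      rintro _ ⟨k, rfl⟩
      exact Submodule.smul_mem _ _ (Submodule.sum_mem _ fun i _ =>
        Submodule.smul_mem _ _ (Submodule.subset_span ⟨i, rfl⟩))
    · rw [finrank_span_eq_card horth.linearIndependent, Fintype.card_fin, hdim]
  have hexp : ∀ i, U i = ∑ k, ⟪ψ k, U i⟫_ℝ • ψ k := by
    intro i
    have hmem : U i ∈ Submodule.span ℝ (Set.range ψ) := by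
      rw [hspan]; exact Submodule.subset_span ⟨i, rfl⟩
    obtain ⟨c, hc⟩ := (Submodule.mem_span_range_iff_exists_fun ℝ).1 hmem
    conv_lhs => rw [← hc]
    refine Finset.sum_congr rfl fun k _ => ?_
    rw [← hc, horth.inner_right_fintype]
  have hproj : ∀ i, Wᗮ.starProjection (U i)
      = ∑ k : Fin l, (if d ≤ (k : ℕ) then ⟪ψ k, U i⟫_ℝ else 0) • ψ k := by
    intro i
    have hlow : ∑ k : Fin l, (if d ≤ (k : ℕ) then 0 else ⟪ψ k, U i⟫_ℝ) • ψ k ∈ W := by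
      refine Submodule.sum_mem _ fun k _ => ?_
      split_ifs with h
      · simp
      · refine Submodule.smul_mem _ _ ?_
        rw [hW]
        exact Submodule.subset_span ⟨k, by simpa using h, rfl⟩
    have hhigh : ∑ k : Fin l, (if d ≤ (k : ℕ) then ⟪ψ k, U i⟫_ℝ else 0) • ψ k ∈ Wᗮ := by
      refine Submodule.sum_mem _ fun k _ => ?_
      split_ifs with h
      · refine Submodule.smul_mem _ _ ?_
        rw [hW, Submodule.mem_orthogonal]
        intro v hv
        induction hv using Submodule.span_induction with
        | mem x hx =>
          obtain ⟨k', hk', rfl⟩ := hx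
          refine horth.2 fun hkk => ?_
          subst hkk
          exact absurd hk' (by simpa using h)
        | zero => simp
        | add x y _ _ hx hy => rw [inner_add_left, hx, hy, add_zero]
        | smul c x _ hx => rw [real_inner_smul_left, hx, mul_zero]
      · simp
    rw [Submodule.starProjection_orthogonal_val, sub_eq_iff_eq_add]
    have hsum : U i = ∑ k : Fin l, (if d ≤ (k : ℕ) then 0 else ⟪ψ k, U i⟫_ℝ) • ψ k
        + ∑ k : Fin l, (if d ≤ (k : ℕ) then ⟪ψ k, U i⟫_ℝ else 0) • ψ k := by
      conv_lhs => rw [hexp i]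
      rw [← Finset.sum_add_distrib]
      refine Finset.sum_congr rfl fun k _ => ?_
      split_ifs <;> simp
    rw [Submodule.eq_starProjection_of_mem_orthogonal' hlow hhigh hsum, add_comm]
    exact hsum
  have hnorm : ∀ i, ‖Wᗮ.starProjection (U i)‖ ^ 2
      = ∑ k : Fin l, if d ≤ (k : ℕ) then L * lam k * a k i ^ 2 else 0 := by
    intro i
    rw [hproj i, ← real_inner_self_eq_norm_sq, horth.inner_sum]
    refine Finset.sum_congr rfl fun k _ => ?_
    split_ifs
    · rw [hin, conj_trivial]; linear_combination (a k i) ^ 2 * hsq k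
    · simp
  simp only [hnorm]
  rw [Finset.sum_comm, tailSum, Finset.mul_sum]
  refine le_of_eq (Finset.sum_congr rfl fun k _ => ?_)
  split_ifs
  · rw [← Finset.mul_sum]
    have := hort k k
    simp only [if_true, ← sq] at this
    rw [this, mul_one]
  · simp

/-! ### Difference quotients in a finite-dimensional space -/

/-- The inverse inequality on a finite-dimensional subspace. -/
theorem exists_norm_le_of_injective (hι : Function.Injective ι) (X : Submodule ℝ E)
    [FiniteDimensional ℝ X] : ∃ Λ : ℝ, 0 < Λ ∧ ∀ v ∈ X, ‖v‖ ≤ Λ * ‖ι v‖ := by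
  obtain ⟨K, hK, h⟩ := LinearMap.exists_antilipschitzWith (ι.comp X.subtype)
    (LinearMap.ker_eq_bot.2 (hι.comp Subtype.val_injective))
  refine ⟨K, by exact_mod_cast hK, fun v hv => ?_⟩
  have := h.le_mul_dist (⟨v, hv⟩ : X) 0
  simpa using this

/-- First differences of the solution are `O(τ)` and second differences `O(τ²)`, with constants
depending on the inverse inequality of `X`, the initial value and the source. -/
theorem IsEulerScheme.diff_le {X : Submodule ℝ E} (h : IsEulerScheme ι τ N F X u) (hτ : 0 < τ)
    {T Λ A K : ℝ} (hT : N * τ = T) (hΛ : 0 < Λ) (hA : 0 ≤ A) (hK : 0 ≤ K)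
    (hinv : ∀ v ∈ X, ‖v‖ ≤ Λ * ‖ι v‖)
    (hF1 : 1 ≤ N → ‖F 1‖ ≤ A) (hF : ∀ n, 1 ≤ n → n + 1 ≤ N → ‖F (n + 1) - F n‖ ≤ K * τ) :
    (∀ n, n + 1 ≤ N → ‖u (n + 1) - u n‖ ≤ Λ * (A + Λ * ‖u 0‖ + T * K) * τ) ∧
    (∀ n, n + 2 ≤ N → ‖u (n + 2) - (2 : ℕ) • u (n + 1) + u n‖
      ≤ Λ * (K + Λ * (Λ * (A + Λ * ‖u 0‖ + T * K))) * τ ^ 2) := by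
  have hmem : ∀ n, n + 1 ≤ N → u (n + 1) - u n ∈ X := fun n hn =>
    X.sub_mem (h.mem _ hn) (h.mem _ (by omega))
  have hmem2 : ∀ n, n + 2 ≤ N → u (n + 2) - (2 : ℕ) • u (n + 1) + u n ∈ X := fun n hn =>
    X.add_mem (X.sub_mem (h.mem _ hn) (X.smul_of_tower_mem _ (h.mem _ (by omega))))
      (h.mem _ (by omega))
  have hδ : ∀ n, n + 1 ≤ N → ‖ι (u (n + 1) - u n)‖ ≤ (A + Λ * ‖u 0‖) * τ + n * (K * τ * τ) := by
    intro n
    induction n with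
    | zero =>
      intro hn
      set w := u (0 + 1) - u 0 with hw
      have e := h.eq 0 hn w (hmem 0 hn)
      have e' : ⟪ι w, ι w⟫_ℝ + τ * ⟪w, w⟫_ℝ = τ * ⟪F 1, ι w⟫_ℝ - τ * ⟪u 0, w⟫_ℝ := by
        have b1 : ⟪ι w, ι w⟫_ℝ = ⟪ι (u (0 + 1)), ι w⟫_ℝ - ⟪ι (u 0), ι w⟫_ℝ := by
          rw [← inner_sub_left, ← map_sub]
        have b2 : ⟪w, w⟫_ℝ = ⟪u (0 + 1), w⟫_ℝ - ⟪u 0, w⟫_ℝ := by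
          rw [← inner_sub_left]
        rw [b1, b2]
        simp only [zero_add] at e ⊢
        linarith
      rw [real_inner_self_eq_norm_sq, real_inner_self_eq_norm_sq] at e'
      have c1 := real_inner_le_norm (F 1) (ι w)
      have c2 := (abs_le.1 (abs_real_inner_le_norm (u 0) w)).1
      have c3 := hinv w (hmem 0 hn)
      have c4 : ‖F 1‖ * ‖ι w‖ ≤ A * ‖ι w‖ := by gcongr; exact hF1 hn
      have c5 : ‖u 0‖ * ‖w‖ ≤ ‖u 0‖ * (Λ * ‖ι w‖) := by gcongr
      have c6 : τ * ⟪F 1, ι w⟫_ℝ - τ * ⟪u 0, w⟫_ℝ ≤ τ * ((A + Λ * ‖u 0‖) * ‖ι w‖) := by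
        rw [← mul_sub]
        gcongr
        linarith
      have c7 : 0 ≤ τ * ‖w‖ ^ 2 := by positivity
      simp only [Nat.cast_zero, zero_mul, add_zero]
      by_contra! hlt
      have : 0 ≤ (A + Λ * ‖u 0‖) * τ := by positivity
      nlinarith
    | succ n ih =>
      intro hn
      have ih := ih (by omega)
      set w := u (n + 1 + 1) - u (n + 1) with hw
      have e1 := h.eq (n + 1) hn w (hmem _ hn)
      have e2 := h.eq n (by omega) w (hmem _ hn)
      have e' : ⟪ι w, ι w⟫_ℝ + τ * ⟪w, w⟫_ℝ
          = ⟪τ • (F (n + 1 + 1) - F (n + 1)) + ι (u (n + 1) - u n), ι w⟫_ℝ := by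
        have b1 : ⟪ι w, ι w⟫_ℝ = ⟪ι (u (n + 1 + 1)), ι w⟫_ℝ - ⟪ι (u (n + 1)), ι w⟫_ℝ := by
          rw [← inner_sub_left, ← map_sub]
        have b2 : ⟪w, w⟫_ℝ = ⟪u (n + 1 + 1), w⟫_ℝ - ⟪u (n + 1), w⟫_ℝ := by
          rw [← inner_sub_left]
        rw [b1, b2]
        simp only [inner_add_left, real_inner_smul_left, inner_sub_left, map_sub]
        linarith
      have c1 := norm_le_of_euler_step hτ.le e'
      have c2 := hF (n + 1) (by omega) hn
      have c3 : ‖τ • (F (n + 1 + 1) - F (n + 1))‖ ≤ τ * (K * τ) := by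
        rw [norm_smul, Real.norm_of_nonneg hτ.le]
        gcongr
      have c4 := norm_add_le (τ • (F (n + 1 + 1) - F (n + 1))) (ι (u (n + 1) - u n))
      push_cast
      nlinarith
  set B := A + Λ * ‖u 0‖ + T * K with hB
  have hδ' : ∀ n, n + 1 ≤ N → ‖ι (u (n + 1) - u n)‖ ≤ B * τ := by
    intro n hn
    refine (hδ n hn).trans ?_
    have : (n : ℝ) * τ ≤ T := by
      rw [← hT]; gcongr; omega
    have : (n : ℝ) * τ * (K * τ) ≤ T * (K * τ) := by gcongr
    rw [hB]
    linarith
  have hfirst : ∀ n, n + 1 ≤ N → ‖u (n + 1) - u n‖ ≤ Λ * B * τ := fun n hn =>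
    (hinv _ (hmem n hn)).trans (by rw [mul_assoc]; gcongr; exact hδ' n hn)
  refine ⟨hfirst, fun n hn => ?_⟩
  set w := u (n + 2) - (2 : ℕ) • u (n + 1) + u n with hw
  have hwX := hmem2 n hn
  have e1 := h.eq (n + 1) hn w hwX
  have e2 := h.eq n (by omega) w hwX
  have e' : ⟪ι w, ι w⟫_ℝ = τ * ⟪F (n + 1 + 1) - F (n + 1), ι w⟫_ℝ
      - τ * ⟪u (n + 1 + 1) - u (n + 1), w⟫_ℝ := by
    have b1 : ⟪ι w, ι w⟫_ℝ = ⟪ι (u (n + 1 + 1)), ι w⟫_ℝ - ⟪ι (u (n + 1)), ι w⟫_ℝ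
        - ⟪ι (u (n + 1)), ι w⟫_ℝ + ⟪ι (u n), ι w⟫_ℝ := by
      rw [← inner_sub_left, ← inner_sub_left, ← inner_add_left, ← map_sub, ← map_sub, ← map_add]
      congr 2
      rw [hw, two_nsmul]; abel
    rw [b1]
    simp only [inner_sub_left]
    linarith
  rw [real_inner_self_eq_norm_sq] at e'
  have c1 := real_inner_le_norm (F (n + 1 + 1) - F (n + 1)) (ι w)
  have c2 := (abs_le.1 (abs_real_inner_le_norm (u (n + 1 + 1) - u (n + 1)) w)).1
  have c3 := hinv w hwX
  have c4 : ‖F (n + 1 + 1) - F (n + 1)‖ * ‖ι w‖ ≤ K * τ * ‖ι w‖ := by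
    gcongr; exact hF (n + 1) (by omega) hn
  have c5 : ‖u (n + 1 + 1) - u (n + 1)‖ * ‖w‖ ≤ (Λ * B * τ) * (Λ * ‖ι w‖) :=
    mul_le_mul (hfirst (n + 1) hn) c3 (norm_nonneg _) ((norm_nonneg _).trans (hfirst (n + 1) hn))
  have c6 : ‖ι w‖ ^ 2 ≤ ((K + Λ * (Λ * B)) * τ ^ 2) * ‖ι w‖ := by
    rw [e', ← mul_sub]
    calc _ ≤ τ * (K * τ * ‖ι w‖ + (Λ * B * τ) * (Λ * ‖ι w‖)) := by gcongr; linarith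
      _ = _ := by ring
  have hB0 : 0 ≤ B := by
    have : 0 ≤ T := by rw [← hT]; positivity
    positivity
  have c7 : ‖ι w‖ ≤ (K + Λ * (Λ * B)) * τ ^ 2 := by
    by_contra! hlt
    have : 0 ≤ (K + Λ * (Λ * B)) * τ ^ 2 := by positivity
    nlinarith
  refine c3.trans ?_
  rw [mul_assoc]
  gcongr

/-! ### The error of the reduced scheme -/

/-- The error of the reduced scheme for uniform snapshots. -/
theorem pod_error_le {X : Submodule ℝ E} {ud : ℕ → E}
    (hu : IsEulerScheme ι τ N F X u) (hd : IsEulerScheme ι τ N F W ud) (hWX : W ≤ X)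
    (hτ : 0 ≤ τ) (h0 : ∀ v ∈ W, ⟪ud 0, v⟫_ℝ = ⟪u 0, v⟫_ℝ) {C : ℝ} (hC0 : 0 ≤ C)
    (hC : ∀ v, ‖ι v‖ ≤ C * ‖v‖) {T σ K : ℝ} (hT : N * τ = T) (hK : 0 ≤ K)
    {L l : ℕ} (hL : 1 ≤ L) {r s : ℕ} (hr : 1 ≤ r) (hrs : r ≤ s)
    (hN : r + (L - 1) * s ≤ N) (hN' : N < r + L * s) (hσ : (N : ℝ) ≤ σ * L)
    (lam : Fin l → ℝ) (a : Fin l → Fin L → ℝ)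
    (hdim : l = Module.finrank ℝ
      (Submodule.span ℝ (Set.range fun i : Fin L => u (r + i * s))))
    (hpos : ∀ k, 0 < lam k)
    (heig : ∀ k (i : Fin L), ∑ j : Fin L, 1 / (L : ℝ) * ⟪u (r + i * s), u (r + j * s)⟫_ℝ * a k j
      = lam k * a k i)
    (hort : ∀ k k', ∑ i, a k i * a k' i = if k = k' then 1 else 0) (d : ℕ)
    (hW : W = Submodule.span ℝ ((fun k => (1 / Real.sqrt (L * lam k)) •
      ∑ i : Fin L, a k i • u (r + i * s)) '' {k : Fin l | (k : ℕ) < d}))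
    (h1 : ∀ n, n + 1 ≤ N → ‖u (n + 1) - u n‖ ≤ K * τ)
    (h2 : ∀ n, n + 2 ≤ N → ‖u (n + 2) - (2 : ℕ) • u (n + 1) + u n‖ ≤ K * τ ^ 2)
    {n : ℕ} (hn : n ≤ N) :
    ‖ι (u n - ud n)‖ ≤ C * (5 * (L * Real.sqrt (tailSum lam d))
      + (8 * σ * K + 4 * σ * K * T) * τ) := by
  have : FiniteDimensional ℝ W := by
    rw [hW]
    exact FiniteDimensional.span_of_finite ℝ (Set.toFinite _)
  have herr := hu.norm_sub_galerkin_le hd hWX hτ h0 hC hn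
  set y : ℕ → E := fun n => Wᗮ.starProjection (u n) with hy
  have hcontr : ∀ x, ‖Wᗮ.starProjection x‖ ≤ ‖x‖ := fun x =>
    Submodule.norm_starProjection_apply_le _ _
  have hy1 : ∀ n, n + 1 ≤ N → ‖y (n + 1) - y n‖ ≤ K * τ := fun n hn => by
    rw [hy]; simp only [← map_sub]; exact (hcontr _).trans (h1 n hn)
  have hy2 : ∀ n, n + 2 ≤ N → ‖y (n + 2) - (2 : ℕ) • y (n + 1) + y n‖ ≤ K * τ ^ 2 := fun n hn => by
    rw [hy]; simp only [← map_sub, ← map_add, ← map_nsmul]; exact (hcontr _).trans (h2 n hn)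
  have hsum := sum_norm_diff_uniform_le hr hrs hL hN hN' hσ (by positivity) (by positivity) hy1 hy2
  have hr0 := norm_le_norm_add_sum_diff y hn (r := r) (by omega)
  have hsub : ∑ j ∈ Finset.range n, ‖y (j + 1) - y j‖ ≤ ∑ j ∈ Finset.range N, ‖y (j + 1) - y j‖ :=
    Finset.sum_le_sum_of_subset_of_nonneg (Finset.range_mono hn) fun _ _ _ => norm_nonneg _
  have hpod := pod_sum_sq_le hL (fun i : Fin L => u (r + i * s)) lam a hdim hpos heig hort W d hW
  have hR : ∑ i ∈ Finset.range L, ‖y (r + i * s)‖ ≤ L * Real.sqrt (tailSum lam d) := by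
    rw [Finset.sum_range]
    have h3 := sq_sum_le_card_mul_sum_sq (s := Finset.univ)
      (f := fun i : Fin L => ‖y (r + i * s)‖)
    rw [Finset.card_univ, Fintype.card_fin] at h3
    have ht : 0 ≤ tailSum lam d := Finset.sum_nonneg fun k _ => by
      split_ifs
      · exact (hpos k).le
      · exact le_rfl
    refine abs_le_of_sq_le_sq' ?_ (by positivity) |>.2
    rw [mul_pow, Real.sq_sqrt ht, sq (L : ℝ), mul_assoc]
    exact h3.trans (by gcongr)
  have hyr : ‖y r‖ ≤ ∑ i ∈ Finset.range L, ‖y (r + i * s)‖ := by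
    have := Finset.single_le_sum (f := fun i => ‖y (r + i * s)‖) (fun _ _ => norm_nonneg _)
      (Finset.mem_range.2 hL)
    simpa using this
  refine herr.trans (mul_le_mul_of_nonneg_left ?_ hC0)
  have e : 2 * σ * N * (K * τ ^ 2) = 2 * σ * K * T * τ := by rw [← hT]; ring
  change ‖y n‖ + ∑ j ∈ Finset.range n, ‖y (j + 1) - y j‖ ≤ _
  linarith

end

/-! ### Riemann-Liouville derivatives of Lipschitz functions -/

/-- The kernel `t ^ (-μ)` of fractional integration of order `1 - μ`, cut off to `0 < t < 1`. The
cut at `1` is harmless for functions on the unit interval and makes the kernel integrable. -/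
noncomputable def fracKer (μ : ℝ) : ℝ → ℝ := indicator (Ioo 0 1) fun t => t ^ (-μ)

theorem fracKer_nonneg (μ t : ℝ) : 0 ≤ fracKer μ t :=
  indicator_nonneg (fun _ h => Real.rpow_nonneg h.1.le _) _

theorem measurable_fracKer (μ : ℝ) : Measurable (fracKer μ) :=
  (measurable_id.pow_const _).indicator measurableSet_Ioo

theorem integrable_fracKer {μ : ℝ} (hμ : μ < 1) : Integrable (fracKer μ) := by
  rw [fracKer, integrable_indicator_iff measurableSet_Ioo]
  exact ((intervalIntegrable_iff_integrableOn_Ioo_of_le zero_le_one).1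
    (intervalIntegral.intervalIntegrable_rpow' (by linarith)))

/-- A convolution with a Lipschitz function is differentiable everywhere although the function is
only differentiable almost everywhere. -/
theorem hasDerivAt_convolution_lipschitz {k g : ℝ → ℝ} (hk : Integrable k) {K : ℝ≥0}
    (hg : LipschitzWith K g) {C : ℝ} (hgC : ∀ x, ‖g x‖ ≤ C) (x : ℝ) :
    HasDerivAt (fun s => ∫ ξ, k (s - ξ) * g ξ) (∫ ξ, k (x - ξ) * deriv g ξ) x := by
  have e : ∀ (f : ℝ → ℝ) (s : ℝ), ∫ ξ, k (s - ξ) * f ξ = ∫ t, k t * f (s - t) := by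
    intro f s
    rw [← integral_sub_left_eq_self (fun ξ => k (s - ξ) * f ξ) volume s]
    simp
  simp only [e]
  have hmp : ∀ s : ℝ, MeasurePreserving (fun t : ℝ => s - t) volume volume :=
    fun s => Measure.measurePreserving_sub_left volume s
  refine (hasDerivAt_integral_of_dominated_loc_of_lip (F := fun s t => k t * g (s - t))
    (bound := fun t => ‖k t‖ * K) Filter.univ_mem ?_ ?_ ?_ ?_ ?_ ?_).2
  · refine Filter.Eventually.of_forall fun s => hk.1.mul ?_
    exact (hg.continuous.comp (by fun_prop)).aestronglyMeasurable
  · refine hk.mul_bdd (c := C) ?_ (Filter.Eventually.of_forall fun t => hgC _)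
    exact (hg.continuous.comp (by fun_prop)).aestronglyMeasurable
  · refine hk.1.mul ?_
    exact ((measurable_deriv g).comp (by fun_prop)).aestronglyMeasurable
  · refine Filter.Eventually.of_forall fun t => LipschitzWith.lipschitzOnWith ?_
    refine LipschitzWith.of_dist_le_mul fun a b => ?_
    rw [Real.dist_eq, ← mul_sub, abs_mul]
    have := hg.dist_le_mul (a - t) (b - t)
    rw [dist_sub_right, Real.dist_eq] at this
    calc |k t| * |g (a - t) - g (b - t)| ≤ |k t| * (K * dist a b) := by gcongr
      _ = _ := by
        simp only [Real.coe_nnabs, abs_mul, Real.norm_eq_abs, abs_abs, NNReal.abs_eq]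
        ring
  · exact hk.norm.mul_const _
  · filter_upwards [(hmp x).quasiMeasurePreserving.ae hg.ae_differentiableAt_real] with t ht
    have h1 := ht.hasDerivAt.comp_sub_const x t
    exact h1.const_mul _

theorem deriv_eq_zero_of_zero_off {g : ℝ → ℝ} (h0 : ∀ x, x ∉ Ioo (0 : ℝ) 1 → g x = 0) {x : ℝ}
    (hx : x ∉ Icc (0 : ℝ) 1) : deriv g x = 0 := by
  have : g =ᶠ[𝓝 x] fun _ => 0 := by
    filter_upwards [isClosed_Icc.isOpen_compl.mem_nhds hx] with y hy
    exact h0 y fun h => hy (Ioo_subset_Icc_self h)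
  rw [this.deriv_eq, deriv_const]

theorem integral_mul_deriv_eq {g : ℝ → ℝ} (h0 : ∀ x, x ∉ Ioo (0 : ℝ) 1 → g x = 0) (k : ℝ → ℝ) :
    ∫ ξ, k ξ * deriv g ξ = ∫ ξ in Ioo (0 : ℝ) 1, k ξ * deriv g ξ := by
  rw [← integral_Icc_eq_integral_Ioo]
  refine (setIntegral_eq_integral_of_forall_compl_eq_zero fun x hx => ?_).symm
  rw [deriv_eq_zero_of_zero_off h0 hx, mul_zero]

theorem norm_le_of_lipschitz_of_zero_off {g : ℝ → ℝ} {K : ℝ≥0} (hg : LipschitzWith K g)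
    (h0 : ∀ x, x ∉ Ioo (0 : ℝ) 1 → g x = 0) (x : ℝ) : ‖g x‖ ≤ K := by
  by_cases hx : x ∈ Ioo (0 : ℝ) 1
  · have h1 := hg.dist_le_mul x 0
    rw [h0 0 (by simp), dist_zero_right, Real.dist_eq, sub_zero, abs_of_pos hx.1] at h1
    nlinarith [hx.2, K.coe_nonneg]
  · rw [h0 x hx, norm_zero]; exact K.coe_nonneg

theorem rlLeft_eq {μ : ℝ} (hμ : μ < 1) {g : ℝ → ℝ} {K : ℝ≥0} (hg : LipschitzWith K g)
    (h0 : ∀ x, x ∉ Ioo (0 : ℝ) 1 → g x = 0) {x : ℝ} (hx : x ∈ Ioo (0 : ℝ) 1) :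
    rlLeft μ 0 g x
      = 1 / Real.Gamma (1 - μ) * ∫ ξ in Ioo (0 : ℝ) 1, fracKer μ (x - ξ) * deriv g ξ := by
  have key : ∀ s ∈ Ioo (0 : ℝ) 1,
      ∫ ξ in (0 : ℝ)..s, (s - ξ) ^ (-μ) * g ξ = ∫ ξ, fracKer μ (s - ξ) * g ξ := by
    intro s hs
    rw [intervalIntegral.integral_of_le hs.1.le, integral_Ioc_eq_integral_Ioo,
      ← integral_indicator measurableSet_Ioo]
    congr 1
    ext ξ
    by_cases h : ξ ∈ Ioo 0 s
    · rw [indicator_of_mem h, fracKer, indicator_of_mem]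
      exact ⟨by linarith [h.2], by linarith [h.1, hs.2]⟩
    · rw [indicator_of_notMem h]
      by_cases h' : 0 < ξ
      · rw [fracKer, indicator_of_notMem, zero_mul]
        exact fun h'' => h ⟨h', by linarith [h''.1]⟩
      · rw [h0 ξ fun h'' => h' h''.1, mul_zero]
  rw [rlLeft]
  congr 1
  rw [← integral_mul_deriv_eq h0 fun ξ => fracKer μ (x - ξ),
    ← (hasDerivAt_convolution_lipschitz (integrable_fracKer hμ) hg
      (norm_le_of_lipschitz_of_zero_off hg h0) x).deriv]
  refine Filter.EventuallyEq.deriv_eq ?_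
  filter_upwards [isOpen_Ioo.mem_nhds hx] with s hs
  exact key s hs

theorem rlRight_eq {μ : ℝ} (hμ : μ < 1) {g : ℝ → ℝ} {K : ℝ≥0} (hg : LipschitzWith K g)
    (h0 : ∀ x, x ∉ Ioo (0 : ℝ) 1 → g x = 0) {x : ℝ} (hx : x ∈ Ioo (0 : ℝ) 1) :
    rlRight μ 1 g x
      = (-1) / Real.Gamma (1 - μ) * ∫ ξ in Ioo (0 : ℝ) 1, fracKer μ (ξ - x) * deriv g ξ := by
  have key : ∀ s ∈ Ioo (0 : ℝ) 1,
      ∫ ξ in s..1, (ξ - s) ^ (-μ) * g ξ = ∫ ξ, fracKer μ (-(s - ξ)) * g ξ := by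
    intro s hs
    rw [intervalIntegral.integral_of_le hs.2.le, integral_Ioc_eq_integral_Ioo,
      ← integral_indicator measurableSet_Ioo]
    congr 1
    ext ξ
    rw [neg_sub]
    by_cases h : ξ ∈ Ioo s 1
    · rw [indicator_of_mem h, fracKer, indicator_of_mem]
      exact ⟨by linarith [h.1], by linarith [h.2, hs.1]⟩
    · rw [indicator_of_notMem h]
      by_cases h' : ξ < 1
      · rw [fracKer, indicator_of_notMem, zero_mul]
        exact fun h'' => h ⟨by linarith [h''.1], h'⟩
      · rw [h0 ξ fun h'' => h' h''.2, mul_zero]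
  have e : ∀ ξ, fracKer μ (ξ - x) = fracKer μ (-(x - ξ)) := fun ξ => by rw [neg_sub]
  rw [rlRight]
  congr 1
  simp only [e]
  rw [← integral_mul_deriv_eq h0 fun ξ => fracKer μ (-(x - ξ)),
    ← (hasDerivAt_convolution_lipschitz (k := fun t => fracKer μ (-t))
      (integrable_fracKer hμ).comp_neg hg (norm_le_of_lipschitz_of_zero_off hg h0) x).deriv]
  refine Filter.EventuallyEq.deriv_eq ?_
  filter_upwards [isOpen_Ioo.mem_nhds hx] with s hs
  exact key s hs

/-! ### Quadratic forms with a factored kernel -/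

/-- Fubini for a quadratic form: if `∫ φ y ξ * ψ y η dν(y) = κ (ξ, η)` for nonnegative `φ`, `ψ`, the
integral over `y` of the product of two integral transforms of `h` is the double integral of `h`
against `κ`. -/
theorem integral_mul_integral_of_kernel {Y : Type*} [MeasurableSpace Y] {ν : Measure Y}
    [SFinite ν] {ρ : Measure ℝ} [SFinite ρ] {φ ψ : Y → ℝ → ℝ}
    (hφm : Measurable φ.uncurry) (hψm : Measurable ψ.uncurry)
    (hφ : ∀ y ξ, 0 ≤ φ y ξ) (hψ : ∀ y ξ, 0 ≤ ψ y ξ)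
    {κ : ℝ × ℝ → ℝ} (hκ : Integrable κ (ρ.prod ρ)) (hκ0 : ∀ᵐ p ∂ρ.prod ρ, 0 ≤ κ p)
    (hκe : ∀ᵐ p ∂ρ.prod ρ, ∫⁻ y, ENNReal.ofReal (φ y p.1 * ψ y p.2) ∂ν = ENNReal.ofReal (κ p))
    {h : ℝ → ℝ} (hm : Measurable h) {K : ℝ} (hK : ∀ x, |h x| ≤ K) :
    Integrable (fun y => (∫ ξ, φ y ξ * h ξ ∂ρ) * ∫ η, ψ y η * h η ∂ρ) ν ∧
    ∫ y, (∫ ξ, φ y ξ * h ξ ∂ρ) * (∫ η, ψ y η * h η ∂ρ) ∂ν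
      = ∫ p, κ p * (h p.1 * h p.2) ∂ρ.prod ρ := by
  have hGm : Measurable fun z : Y × ℝ × ℝ => φ z.1 z.2.1 * ψ z.1 z.2.2 := by
    have h1 : Measurable fun z : Y × ℝ × ℝ => φ z.1 z.2.1 :=
      hφm.comp (measurable_fst.prodMk (measurable_fst.comp measurable_snd))
    have h2 : Measurable fun z : Y × ℝ × ℝ => ψ z.1 z.2.2 :=
      hψm.comp (measurable_fst.prodMk (measurable_snd.comp measurable_snd))
    exact h1.mul h2
  have hhm : Measurable fun p : ℝ × ℝ => h p.1 * h p.2 :=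
    (hm.comp measurable_fst).mul (hm.comp measurable_snd)
  have hsec : ∀ᵐ p ∂ρ.prod ρ, Integrable (fun y => φ y p.1 * ψ y p.2) ν ∧
      ∫ y, φ y p.1 * ψ y p.2 ∂ν = κ p := by
    filter_upwards [hκe, hκ0] with p hp hp0
    have hmeas : Measurable fun y => φ y p.1 * ψ y p.2 := hGm.comp measurable_prodMk_right
    have hnn : ∀ y, 0 ≤ φ y p.1 * ψ y p.2 := fun y => mul_nonneg (hφ _ _) (hψ _ _)
    refine ⟨⟨hmeas.aestronglyMeasurable, ?_⟩, ?_⟩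
    · rw [hasFiniteIntegral_iff_ofReal (Filter.Eventually.of_forall hnn), hp]
      exact ENNReal.ofReal_lt_top
    · rw [integral_eq_lintegral_of_nonneg_ae (Filter.Eventually.of_forall hnn)
        hmeas.aestronglyMeasurable, hp, ENNReal.toReal_ofReal hp0]
  have hint : Integrable
      (fun z : Y × ℝ × ℝ => φ z.1 z.2.1 * ψ z.1 z.2.2 * (h z.2.1 * h z.2.2))
      (ν.prod (ρ.prod ρ)) := by
    have hmeas : Measurable fun z : Y × ℝ × ℝ =>
        φ z.1 z.2.1 * ψ z.1 z.2.2 * (h z.2.1 * h z.2.2) := hGm.mul (hhm.comp measurable_snd)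
    rw [integrable_prod_iff' hmeas.aestronglyMeasurable]
    constructor
    · filter_upwards [hsec] with p hp
      exact hp.1.mul_const _
    · have : Integrable (fun p : ℝ × ℝ => κ p * ‖h p.1 * h p.2‖) (ρ.prod ρ) := by
        refine hκ.mul_bdd (c := K * K) hhm.norm.aestronglyMeasurable
          (Filter.Eventually.of_forall fun p => ?_)
        rw [norm_norm, norm_mul]
        exact mul_le_mul (hK _) (hK _) (abs_nonneg _) ((abs_nonneg _).trans (hK 0))
      refine this.congr ?_
      filter_upwards [hsec] with p hp
      rw [← hp.2, ← integral_mul_const]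
      refine integral_congr_ae (Filter.Eventually.of_forall fun y => ?_)
      simp only [norm_mul, Real.norm_of_nonneg (hφ _ _), Real.norm_of_nonneg (hψ _ _)]
  have hprod : ∀ y, (∫ ξ, φ y ξ * h ξ ∂ρ) * ∫ η, ψ y η * h η ∂ρ
      = ∫ p, φ y p.1 * ψ y p.2 * (h p.1 * h p.2) ∂ρ.prod ρ := by
    intro y
    rw [← integral_prod_mul]
    refine integral_congr_ae (Filter.Eventually.of_forall fun p => ?_)
    ring
  simp only [hprod]
  refine ⟨hint.integral_prod_left, ?_⟩
  rw [integral_integral_swap hint]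
  refine integral_congr_ae ?_
  filter_upwards [hsec] with p hp
  rw [integral_mul_const, hp.2]

/-! ### The Riesz kernel -/

theorem ae_unit_square : ∀ᵐ p ∂((volume.restrict (Ioo (0 : ℝ) 1)).prod
    (volume.restrict (Ioo (0 : ℝ) 1))),
    p.1 ∈ Ioo (0 : ℝ) 1 ∧ p.2 ∈ Ioo (0 : ℝ) 1 ∧ p.1 ≠ p.2 := by
  rw [Measure.ae_prod_iff_ae_ae]
  · filter_upwards [ae_restrict_mem measurableSet_Ioo] with ξ hξ
    filter_upwards [ae_restrict_mem measurableSet_Ioo,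
      ae_restrict_of_ae (Measure.ae_ne volume ξ)] with η hη hne
    exact ⟨hξ, hη, hne.symm⟩
  · exact (measurable_fst measurableSet_Ioo).inter ((measurable_snd measurableSet_Ioo).inter
      (measurableSet_eq_fun measurable_fst measurable_snd).compl)

theorem integrable_rieszKernel {s : ℝ} (hs : -1 < s) :
    Integrable (fun p : ℝ × ℝ => |p.1 - p.2| ^ s)
      ((volume.restrict (Ioo (0 : ℝ) 1)).prod (volume.restrict (Ioo (0 : ℝ) 1))) := by
  set w : ℝ → ℝ := fun t => fracKer (-s) t + fracKer (-s) (-t) with hw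
  have hwi : Integrable w :=
    (integrable_fracKer (by linarith)).add (integrable_fracKer (by linarith)).comp_neg
  have h1 : Integrable (indicator (Ioo (0 : ℝ) 1) fun _ => (1 : ℝ)) := by
    rw [integrable_indicator_iff measurableSet_Ioo]
    exact integrableOn_const (by simp)
  have h2 := (h1.convolution_integrand (ContinuousLinearMap.mul ℝ ℝ) hwi)
  have h3 := h2.mono_measure (Measure.prod_mono (Measure.restrict_le_self (s := Ioo (0 : ℝ) 1))
    (Measure.restrict_le_self (s := Ioo (0 : ℝ) 1)))
  refine h3.congr ?_
  filter_upwards [ae_unit_square] with p hp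
  obtain ⟨hp1, hp2, hne⟩ := hp
  simp only [ContinuousLinearMap.mul_apply', indicator_of_mem hp2, one_mul, hw, fracKer, neg_neg,
    neg_sub]
  rcases lt_or_gt_of_ne hne with h | h
  · rw [indicator_of_notMem (fun h' => by linarith [h'.1]), indicator_of_mem, zero_add,
      abs_of_neg (by linarith), neg_sub]
    exact ⟨by linarith, by linarith [hp1.1, hp2.2]⟩
  · rw [indicator_of_mem, indicator_of_notMem (fun h' => by linarith [h'.1]), add_zero,
      abs_of_pos (by linarith)]
    exact ⟨by linarith, by linarith [hp2.1, hp1.2]⟩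

theorem integrable_beta {μ : ℝ} (hμ : μ < 1) :
    Integrable fun x => fracKer μ x * fracKer μ (1 - x) := by
  have h := Complex.betaIntegral_convergent (u := ((1 - μ : ℝ) : ℂ)) (v := ((1 - μ : ℝ) : ℂ))
    (by simpa using hμ) (by simpa using hμ)
  have h1 := ((intervalIntegrable_iff_integrableOn_Ioo_of_le zero_le_one).1 h).norm
  rw [← IntegrableOn, ← integrable_indicator_iff measurableSet_Ioo] at h1
  refine h1.congr (Filter.Eventually.of_forall fun x => ?_)
  by_cases hx : x ∈ Ioo (0 : ℝ) 1
  · have hx' : 1 - x ∈ Ioo (0 : ℝ) 1 := ⟨by linarith [hx.2], by linarith [hx.1]⟩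
    have e : (1 : ℂ) - x = ((1 - x : ℝ) : ℂ) := by push_cast; ring
    simp only [indicator_of_mem hx, indicator_of_mem hx', fracKer, norm_mul, e]
    rw [Complex.norm_cpow_eq_rpow_re_of_pos hx.1, Complex.norm_cpow_eq_rpow_re_of_pos hx'.1]
    simp
  · simp [fracKer, indicator_of_notMem hx]

/-- The beta function at `(1 - μ, 1 - μ)`. -/
noncomputable def betaConst (μ : ℝ) : ℝ := ∫ x, fracKer μ x * fracKer μ (1 - x)

theorem betaConst_pos {μ : ℝ} (hμ : μ < 1) : 0 < betaConst μ := by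
  rw [betaConst, integral_pos_iff_support_of_nonneg
    (fun x => mul_nonneg (fracKer_nonneg _ _) (fracKer_nonneg _ _)) (integrable_beta hμ)]
  have : Ioo (0 : ℝ) 1 ⊆ Function.support fun x => fracKer μ x * fracKer μ (1 - x) := by
    intro x hx
    have hx' : 1 - x ∈ Ioo (0 : ℝ) 1 := ⟨by linarith [hx.2], by linarith [hx.1]⟩
    rw [Function.mem_support, fracKer, indicator_of_mem hx, indicator_of_mem hx']
    exact (mul_pos (Real.rpow_pos_of_pos hx.1 _) (Real.rpow_pos_of_pos hx'.1 _)).ne'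
  refine lt_of_lt_of_le ?_ (measure_mono this)
  simp

/-- The composition of the left and the right kernel is a one-sided Riesz kernel, by scaling to the
beta integral. -/
theorem lintegral_fracKer_mul {μ : ℝ} (hμ : μ < 1) {ξ η : ℝ} (hξ : ξ ∈ Ioo (0 : ℝ) 1)
    (hη : η ∈ Ioo (0 : ℝ) 1) :
    ∫⁻ x, ENNReal.ofReal (fracKer μ (x - ξ) * fracKer μ (η - x))
      = ENNReal.ofReal (if ξ < η then betaConst μ * |ξ - η| ^ (1 - 2 * μ) else 0) := by
  split_ifs with hlt
  · set t := η - ξ with ht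
    have ht0 : 0 < t := by linarith
    have ht1 : t < 1 := by linarith [hξ.1, hη.2]
    have e : ∀ x, fracKer μ (x - ξ) * fracKer μ (η - x)
        = t ^ (-(2 * μ)) * (fracKer μ ((x - ξ) / t) * fracKer μ (1 - (x - ξ) / t)) := by
      intro x
      have e1 : 1 - (x - ξ) / t = (η - x) / t := by
        field_simp; rw [ht]; ring
      rw [e1]
      by_cases hx : x ∈ Ioo ξ η
      · have a1 : 0 < x - ξ := by linarith [hx.1]
        have a2 : 0 < η - x := by linarith [hx.2]
        rw [fracKer, indicator_of_mem, indicator_of_mem, indicator_of_mem, indicator_of_mem,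
          Real.div_rpow a1.le ht0.le, Real.div_rpow a2.le ht0.le]
        · have : t ^ (-(2 * μ)) = t ^ (-μ) * t ^ (-μ) := by
            rw [← Real.rpow_add ht0]; congr 1; ring
          rw [this]
          have := (Real.rpow_pos_of_pos ht0 (-μ)).ne'
          field_simp
        · exact ⟨by positivity, by rw [div_lt_one ht0]; linarith [hx.1]⟩
        · exact ⟨by positivity, by rw [div_lt_one ht0]; linarith [hx.2]⟩
        · exact ⟨a2, by linarith [hx.1]⟩
        · exact ⟨a1, by linarith [hx.2]⟩
      · rcases le_or_gt x ξ with h | h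
        · have a1 : x - ξ ≤ 0 := by linarith
          rw [fracKer, indicator_of_notMem (a := x - ξ) fun h' => not_lt.2 a1 h'.1,
            indicator_of_notMem (a := (x - ξ) / t) fun h' =>
              not_lt.2 (div_nonpos_of_nonpos_of_nonneg a1 ht0.le) h'.1]
          simp
        · have a2 : η - x ≤ 0 := by
            by_contra! h'
            exact hx ⟨h, by linarith⟩
          rw [fracKer, indicator_of_notMem (a := η - x) fun h' => not_lt.2 a2 h'.1,
            indicator_of_notMem (a := (η - x) / t)
              fun h' => not_lt.2 (div_nonpos_of_nonpos_of_nonneg a2 ht0.le) h'.1]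
          simp
    have hi : Integrable fun x => fracKer μ (x - ξ) * fracKer μ (η - x) := by
      simp only [e]
      exact (((integrable_beta hμ).comp_div ht0.ne').comp_sub_right ξ).const_mul _
    rw [← ofReal_integral_eq_lintegral_ofReal hi (Filter.Eventually.of_forall
      fun x => mul_nonneg (fracKer_nonneg _ _) (fracKer_nonneg _ _))]
    congr 1
    simp only [e]
    rw [integral_const_mul,
      integral_sub_right_eq_self (fun x => fracKer μ (x / t) * fracKer μ (1 - x / t)) ξ,
      Measure.integral_comp_div (fun x => fracKer μ x * fracKer μ (1 - x)) t, ← betaConst,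
      abs_of_pos ht0, abs_sub_comm, ← ht, abs_of_pos ht0, smul_eq_mul, ← mul_assoc, mul_comm]
    congr 1
    rw [sub_eq_add_neg, Real.rpow_add ht0, Real.rpow_one, mul_comm]
  · rw [ENNReal.ofReal_zero]
    refine lintegral_eq_zero_of_ae_eq_zero (Filter.Eventually.of_forall fun x => ?_)
    have : fracKer μ (x - ξ) * fracKer μ (η - x) = 0 := by
      rcases le_or_gt x ξ with h | h
      · rw [fracKer, indicator_of_notMem fun h' => by linarith [h'.1], zero_mul]
      · rw [fracKer, indicator_of_notMem (a := η - x) fun h' => by linarith [h'.1], mul_zero]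
    simp [this]

theorem lintegral_Ioi_rpow {a c : ℝ} (ha : a < -1) (hc : 0 < c) :
    ∫⁻ t, indicator (Ioi c) (fun t => ENNReal.ofReal (t ^ a)) t
      = ENNReal.ofReal (c ^ (a + 1) / (-(a + 1))) := by
  rw [lintegral_indicator measurableSet_Ioi, ← ofReal_integral_eq_lintegral_ofReal
    (integrableOn_Ioi_rpow_of_lt ha hc), integral_Ioi_rpow_of_lt ha hc]
  · rw [neg_div, div_neg]
  · filter_upwards [ae_restrict_mem measurableSet_Ioi] with t ht
    exact Real.rpow_nonneg (hc.trans ht).le _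

/-- The indicator of the interval `(y.1, y.2)`, weighted by the power `-(α + 1) / 2` of its length,
so that products of two of them integrate over `y` to a Riesz kernel. -/
noncomputable def intervalKer (α : ℝ) (y : ℝ × ℝ) (ξ : ℝ) : ℝ :=
  indicator (Ioo y.1 y.2) (fun _ => (y.2 - y.1) ^ (-(α + 1) / 2)) ξ

theorem intervalKer_nonneg (α : ℝ) (y : ℝ × ℝ) (ξ : ℝ) : 0 ≤ intervalKer α y ξ :=
  indicator_nonneg (fun _ h => Real.rpow_nonneg (by linarith [h.1, h.2]) _) _

theorem measurable_intervalKer (α : ℝ) : Measurable (intervalKer α).uncurry := by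
  have h1 : Measurable fun z : (ℝ × ℝ) × ℝ => (z.1.2 - z.1.1) ^ (-(α + 1) / 2) :=
    (by fun_prop : Measurable fun z : (ℝ × ℝ) × ℝ => z.1.2 - z.1.1).pow_const _
  have h2 : MeasurableSet ({z : (ℝ × ℝ) × ℝ | z.1.1 < z.2} ∩ {z | z.2 < z.1.2}) :=
    (measurableSet_lt (by fun_prop) (by fun_prop)).inter
      (measurableSet_lt (by fun_prop) (by fun_prop))
  exact h1.indicator h2

/-- The Riesz kernel is a superposition of products of indicators of intervals. -/
theorem lintegral_intervalKer_mul {α : ℝ} (hα : 1 < α) {ξ η : ℝ} (hne : ξ ≠ η) :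
    ∫⁻ y, ENNReal.ofReal (intervalKer α y ξ * intervalKer α y η)
      = ENNReal.ofReal (|ξ - η| ^ (1 - α) / (α * (α - 1))) := by
  wlog hlt : ξ < η generalizing ξ η
  · rw [abs_sub_comm, ← this hne.symm (lt_of_le_of_ne (not_lt.1 hlt) hne.symm)]
    simp only [mul_comm]
  have hm : Measurable fun y : ℝ × ℝ =>
      ENNReal.ofReal (intervalKer α y ξ * intervalKer α y η) :=
    (((measurable_intervalKer α).comp measurable_prodMk_right).mul
      ((measurable_intervalKer α).comp measurable_prodMk_right)).ennreal_ofReal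
  rw [Measure.volume_eq_prod, lintegral_prod _ hm.aemeasurable]
  have hinner : ∀ p, ∫⁻ q, ENNReal.ofReal (intervalKer α (p, q) ξ * intervalKer α (p, q) η)
      = ENNReal.ofReal (1 / α) *
        indicator (Ioi (η - ξ)) (fun t => ENNReal.ofReal (t ^ (-α))) (η - p) := by
    intro p
    by_cases hp : p < ξ
    · have e : ∀ q, ENNReal.ofReal (intervalKer α (p, q) ξ * intervalKer α (p, q) η)
          = indicator (Ioi (η - p)) (fun t => ENNReal.ofReal (t ^ (-α - 1))) (q - p) := by
        intro q
        by_cases hq : η < q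
        · rw [intervalKer, intervalKer, indicator_of_mem (show ξ ∈ Ioo p q from ⟨hp, by linarith⟩),
            indicator_of_mem (show η ∈ Ioo p q from ⟨by linarith, hq⟩),
            indicator_of_mem (show q - p ∈ Ioi (η - p) by simpa using hq),
            ← Real.rpow_add (by simp; linarith)]
          congr 2
          ring
        · rw [intervalKer, intervalKer, indicator_of_notMem (a := η) (fun h => hq h.2),
            indicator_of_notMem (a := q - p) (by simpa using hq)]
          simp
      simp only [e]
      rw [lintegral_sub_right_eq_self
        (indicator (Ioi (η - p)) (fun t => ENNReal.ofReal (t ^ (-α - 1)))) p,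
        lintegral_Ioi_rpow (by linarith) (by linarith), indicator_of_mem (by simpa using hp),
        ← ENNReal.ofReal_mul (by positivity)]
      congr 1
      rw [show -α - 1 + 1 = -α by ring, neg_neg]
      ring
    · rw [indicator_of_notMem (by simpa using hp), mul_zero]
      refine lintegral_eq_zero_of_ae_eq_zero (Filter.Eventually.of_forall fun q => ?_)
      simp [intervalKer, indicator_of_notMem (show ξ ∉ Ioo p q from fun h => hp h.1)]
  simp only [hinner]
  rw [lintegral_const_mul' _ _ ENNReal.ofReal_ne_top, lintegral_sub_left_eq_self
      (indicator (Ioi (η - ξ)) (fun t => ENNReal.ofReal (t ^ (-α)))) η,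
    lintegral_Ioi_rpow (by linarith) (by linarith), ← ENNReal.ofReal_mul (by positivity)]
  congr 1
  rw [abs_sub_comm, abs_of_pos (by linarith), show -α + 1 = 1 - α by ring, neg_sub,
    div_mul_div_comm, one_mul]

theorem integral_intervalKer_mul_deriv (α : ℝ) {g : ℝ → ℝ} {K : ℝ≥0} (hg : LipschitzWith K g)
    (h0 : ∀ x, x ∉ Ioo (0 : ℝ) 1 → g x = 0) {y : ℝ × ℝ} (hy1 : y.1 ∈ Ioo (0 : ℝ) 1)
    (hy2 : y.2 ∈ Ioo (1 : ℝ) 2) :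
    ∫ ξ in Ioo (0 : ℝ) 1, intervalKer α y ξ * deriv g ξ
      = (y.2 - y.1) ^ (-(α + 1) / 2) * -g y.1 := by
  have e1 : ∫ ξ in Ioo (0 : ℝ) 1, intervalKer α y ξ * deriv g ξ
      = ∫ ξ in Ioo y.1 1, (y.2 - y.1) ^ (-(α + 1) / 2) * deriv g ξ := by
    rw [← integral_indicator measurableSet_Ioo, ← integral_indicator measurableSet_Ioo]
    congr 1
    ext ξ
    by_cases h : ξ ∈ Ioo y.1 1
    · rw [indicator_of_mem h, indicator_of_mem (show ξ ∈ Ioo (0 : ℝ) 1 from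
        ⟨hy1.1.trans h.1, h.2⟩), intervalKer, indicator_of_mem (show ξ ∈ Ioo y.1 y.2 from
        ⟨h.1, h.2.trans hy2.1⟩)]
    · rw [indicator_of_notMem h]
      by_cases h' : ξ ∈ Ioo (0 : ℝ) 1
      · rw [indicator_of_mem h', intervalKer, indicator_of_notMem, zero_mul]
        exact fun h'' => h ⟨h''.1, h'.2⟩
      · rw [indicator_of_notMem h']
  have hac : AbsolutelyContinuousOnInterval g y.1 1 :=
    (hg.lipschitzOnWith (s := uIcc y.1 1)).absolutelyContinuousOnInterval
  have e2 := hac.integral_deriv_eq_sub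
  rw [h0 1 (by simp), zero_sub, intervalIntegral.integral_of_le hy1.2.le,
    integral_Ioc_eq_integral_Ioo] at e2
  rw [e1, integral_const_mul, e2]

/-- Coercivity of the one-dimensional energy form, with a constant depending only on `α`. -/
theorem exists_coercive_rl {α : ℝ} (hα1 : 1 < α) (hα2 : α < 2) : ∃ c : ℝ, 0 < c ∧
    ∀ (g : ℝ → ℝ) (K : ℝ≥0), LipschitzWith K g → (∀ x, x ∉ Ioo (0 : ℝ) 1 → g x = 0) →
      c * ∫ x in Ioo (0 : ℝ) 1, g x ^ 2
        ≤ -∫ x in Ioo (0 : ℝ) 1, rlLeft (α / 2) 0 g x * rlRight (α / 2) 1 g x := by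
  set μ := α / 2 with hμ
  have hμ1 : μ < 1 := by rw [hμ]; linarith
  set ρ := volume.restrict (Ioo (0 : ℝ) 1) with hρ
  set B := betaConst μ with hB
  have hB0 : 0 < B := betaConst_pos hμ1
  set G := Real.Gamma (1 - μ) with hG
  have hG0 : 0 < G := Real.Gamma_pos_of_pos (by linarith)
  have hα0 : 0 < α * (α - 1) := mul_pos (by linarith) (by linarith)
  refine ⟨1 / G ^ 2 * (1 / 2 * (B * (α * (α - 1)) * 2 ^ (-(α + 1)))), by positivity, ?_⟩
  intro g K hg h0
  set h := deriv g with hh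
  have hm : Measurable h := measurable_deriv g
  have hK : ∀ x, |h x| ≤ K := fun x => norm_deriv_le_of_lipschitz hg
  have hR : Integrable (fun p : ℝ × ℝ => |p.1 - p.2| ^ (1 - α)) (ρ.prod ρ) :=
    integrable_rieszKernel (by linarith)
  -- the two orders of the kernels give the two halves `ξ < η` and `η < ξ` of the Riesz kernel
  have hkm : Measurable (fun (x ξ : ℝ) => fracKer μ (x - ξ)).uncurry :=
    (measurable_fracKer μ).comp (by fun_prop : Measurable fun z : ℝ × ℝ => z.1 - z.2)
  have hkm' : Measurable (fun (x η : ℝ) => fracKer μ (η - x)).uncurry :=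
    (measurable_fracKer μ).comp (by fun_prop : Measurable fun z : ℝ × ℝ => z.2 - z.1)
  have hKi : ∀ S : Set (ℝ × ℝ), MeasurableSet S →
      Integrable (S.indicator fun p : ℝ × ℝ => B * |p.1 - p.2| ^ (1 - α)) (ρ.prod ρ) :=
    fun S hS => (hR.const_mul B).indicator hS
  have hS1 : MeasurableSet {p : ℝ × ℝ | p.1 < p.2} := measurableSet_lt measurable_fst measurable_snd
  have hS2 : MeasurableSet {p : ℝ × ℝ | p.2 < p.1} := measurableSet_lt measurable_snd measurable_fst
  have hnn : ∀ S : Set (ℝ × ℝ), ∀ᵐ p ∂ρ.prod ρ,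
      0 ≤ S.indicator (fun p : ℝ × ℝ => B * |p.1 - p.2| ^ (1 - α)) p := fun S =>
    Filter.Eventually.of_forall fun p => indicator_nonneg (fun _ _ => by positivity) _
  have hexp : 1 - 2 * μ = 1 - α := by rw [hμ]; ring
  have k1 := integral_mul_integral_of_kernel (ν := volume) hkm hkm'
    (fun _ _ => fracKer_nonneg _ _) (fun _ _ => fracKer_nonneg _ _) (hKi _ hS1) (hnn _) (by
      filter_upwards [ae_unit_square] with p hp
      rw [lintegral_fracKer_mul hμ1 hp.1 hp.2.1, hexp]
      rfl) hm hK
  have k2 := integral_mul_integral_of_kernel (ν := volume) hkm' hkm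
    (fun _ _ => fracKer_nonneg _ _) (fun _ _ => fracKer_nonneg _ _) (hKi _ hS2) (hnn _) (by
      filter_upwards [ae_unit_square] with p hp
      simp only [mul_comm (fracKer μ (p.1 - _))]
      rw [lintegral_fracKer_mul hμ1 hp.2.1 hp.1, hexp, abs_sub_comm]
      rfl) hm hK
  have k3 := integral_mul_integral_of_kernel (ν := (volume : Measure (ℝ × ℝ)))
    (measurable_intervalKer α) (measurable_intervalKer α)
    (intervalKer_nonneg α) (intervalKer_nonneg α) (hR.div_const (α * (α - 1)))
    (Filter.Eventually.of_forall fun p => by positivity) (by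
      filter_upwards [ae_unit_square] with p hp
      exact lintegral_intervalKer_mul hα1 hp.2.2) hm hK
  set A : ℝ → ℝ := fun x => ∫ ξ, fracKer μ (x - ξ) * h ξ ∂ρ with hA
  set A' : ℝ → ℝ := fun x => ∫ ξ, fracKer μ (ξ - x) * h ξ ∂ρ with hA'
  set J := ∫ y, (∫ ξ, intervalKer α y ξ * h ξ ∂ρ) * (∫ ξ, intervalKer α y ξ * h ξ ∂ρ) with hJ
  have hQ : 2 * ∫ x, A x * A' x = B * (α * (α - 1)) * J := by
    have e2 : ∫ x, A' x * A x = ∫ x, A x * A' x := by simp only [mul_comm]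
    have hbd : ∀ κ : ℝ × ℝ → ℝ, Integrable κ (ρ.prod ρ) →
        Integrable (fun p : ℝ × ℝ => κ p * (h p.1 * h p.2)) (ρ.prod ρ) := fun κ hκ => by
      refine hκ.mul_bdd (c := K * K) ((hm.comp measurable_fst).mul
        (hm.comp measurable_snd)).aestronglyMeasurable (Filter.Eventually.of_forall fun p => ?_)
      rw [norm_mul]
      exact mul_le_mul (hK _) (hK _) (abs_nonneg _) K.coe_nonneg
    have e3 : 2 * ∫ x, A x * A' x = (∫ x, A x * A' x) + ∫ x, A' x * A x := by rw [e2]; ring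
    have k1' : ∫ x, A x * A' x = _ := k1.2
    have k2' : ∫ x, A' x * A x = _ := k2.2
    rw [e3, k1', k2', k3.2, ← integral_add (hbd _ (hKi _ hS1)) (hbd _ (hKi _ hS2)),
      ← integral_const_mul]
    refine integral_congr_ae ?_
    filter_upwards [ae_unit_square] with p hp
    have hα0' : α ≠ 0 := (by linarith : 0 < α).ne'
    have hα1' : α - 1 ≠ 0 := (by linarith : 0 < α - 1).ne'
    rcases lt_or_gt_of_ne hp.2.2 with hlt | hlt
    · rw [indicator_of_mem (show p ∈ {p : ℝ × ℝ | p.1 < p.2} from hlt),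
        indicator_of_notMem (show p ∉ {p : ℝ × ℝ | p.2 < p.1} from hlt.asymm)]
      field_simp
      ring
    · rw [indicator_of_mem (show p ∈ {p : ℝ × ℝ | p.2 < p.1} from hlt),
        indicator_of_notMem (show p ∉ {p : ℝ × ℝ | p.1 < p.2} from hlt.asymm)]
      field_simp
      ring
  have hJge : 2 ^ (-(α + 1)) * ∫ x, g x ^ 2 ∂ρ ≤ J := by
    -- intervals with one end beyond the support of `g` already control `∫ g ^ 2`
    set S : Set (ℝ × ℝ) := Ioo (0 : ℝ) 1 ×ˢ Ioo (1 : ℝ) 2 with hS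
    have hSm : MeasurableSet S := measurableSet_Ioo.prod measurableSet_Ioo
    have s1 : ∫ y in S, (∫ ξ, intervalKer α y ξ * h ξ ∂ρ) * (∫ ξ, intervalKer α y ξ * h ξ ∂ρ)
        ≤ J :=
      setIntegral_le_integral k3.1 (Filter.Eventually.of_forall fun y => mul_self_nonneg _)
    refine le_trans ?_ s1
    have s2 : ∫ y in S, g y.1 ^ 2 = ∫ x, g x ^ 2 ∂ρ := by
      rw [hS, Measure.volume_eq_prod, ← Measure.prod_restrict]
      have := integral_prod_mul (μ := ρ) (ν := volume.restrict (Ioo (1 : ℝ) 2))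
        (fun x => g x ^ 2) (fun _ => (1 : ℝ))
      simp only [mul_one] at this
      rw [this]
      simp
      norm_num
    rw [← s2, ← integral_const_mul]
    refine setIntegral_mono_on ?_ k3.1.integrableOn hSm ?_
    · refine Integrable.const_mul ?_ _
      refine Measure.integrableOn_of_bounded (M := (K : ℝ) ^ 2) ?_ ?_ ?_
      · rw [hS, Measure.volume_eq_prod, Measure.prod_prod]; simp
      · exact ((hg.continuous.comp continuous_fst).pow 2).aestronglyMeasurable
      · refine Filter.Eventually.of_forall fun y => ?_
        rw [norm_pow]
        gcongr
        exact norm_le_of_lipschitz_of_zero_off hg h0 _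
    · intro y hy
      rw [integral_intervalKer_mul_deriv α hg h0 hy.1 hy.2]
      have p1 : 0 < y.2 - y.1 := by linarith [hy.1.2, hy.2.1]
      have p2 : y.2 - y.1 ≤ 2 := by linarith [hy.1.1, hy.2.2]
      have p3 : (y.2 - y.1) ^ (-(α + 1) / 2) * (y.2 - y.1) ^ (-(α + 1) / 2)
          = (y.2 - y.1) ^ (-(α + 1)) := by
        rw [← Real.rpow_add p1]; congr 1; ring
      have p4 : (2 : ℝ) ^ (-(α + 1)) ≤ (y.2 - y.1) ^ (-(α + 1)) :=
        Real.rpow_le_rpow_of_nonpos p1 p2 (by linarith)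
      calc _ ≤ (y.2 - y.1) ^ (-(α + 1)) * g y.1 ^ 2 := by gcongr
        _ = _ := by rw [← p3]; ring
  have hrl : ∫ x in Ioo (0 : ℝ) 1, rlLeft μ 0 g x * rlRight μ 1 g x
      = -(1 / G ^ 2 * ∫ x, A x * A' x) := by
    have e1 : ∫ x, A x * A' x = ∫ x in Ioo (0 : ℝ) 1, A x * A' x := by
      refine (setIntegral_eq_integral_of_forall_compl_eq_zero fun x hx => ?_).symm
      by_cases hx0 : 0 < x
      · have : A' x = 0 := by
          refine integral_eq_zero_of_ae ?_
          filter_upwards [ae_restrict_mem measurableSet_Ioo] with ξ hξ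
          have : ξ - x ∉ Ioo (0 : ℝ) 1 := fun h' => hx ⟨hx0, by linarith [h'.1, hξ.2]⟩
          simp [fracKer, indicator_of_notMem this]
        rw [this, mul_zero]
      · have : A x = 0 := by
          refine integral_eq_zero_of_ae ?_
          filter_upwards [ae_restrict_mem measurableSet_Ioo] with ξ hξ
          have : x - ξ ∉ Ioo (0 : ℝ) 1 := fun h' => hx0 (by linarith [h'.1, hξ.1])
          simp [fracKer, indicator_of_notMem this]
        rw [this, zero_mul]
    rw [e1, ← integral_const_mul, ← integral_neg]
    refine setIntegral_congr_fun measurableSet_Ioo fun x hx => ?_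
    simp only [rlLeft_eq hμ1 hg h0 hx, rlRight_eq hμ1 hg h0 hx, hA, hA', ← hh, ← hG, ← hρ]
    ring
  rw [hrl, neg_neg, mul_assoc]
  have hfin : 1 / 2 * (B * (α * (α - 1)) * 2 ^ (-(α + 1))) * ∫ x, g x ^ 2 ∂ρ
      ≤ ∫ x, A x * A' x := by
    have := mul_le_mul_of_nonneg_left hJge (by positivity : 0 ≤ B * (α * (α - 1)))
    nlinarith
  exact mul_le_mul_of_nonneg_left hfin (by positivity)

/-! ### The energy form on Lipschitz functions -/

theorem integral_mul_deriv_add_smul {k g f : ℝ → ℝ} (hk : Integrable k) {K K' : ℝ≥0}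
    (hg : LipschitzWith K g) (hf : LipschitzWith K' f) (c : ℝ) :
    ∫ ξ in Ioo (0 : ℝ) 1, k ξ * deriv (fun s => g s + c * f s) ξ
      = (∫ ξ in Ioo (0 : ℝ) 1, k ξ * deriv g ξ) + c * ∫ ξ in Ioo (0 : ℝ) 1, k ξ * deriv f ξ := by
  have hi : ∀ {K : ℝ≥0} {g : ℝ → ℝ}, LipschitzWith K g →
      Integrable (fun ξ => k ξ * deriv g ξ) (volume.restrict (Ioo (0 : ℝ) 1)) :=
    fun {K g} hg => hk.integrableOn.mul_bdd (c := K) (measurable_deriv g).aestronglyMeasurable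
      (Filter.Eventually.of_forall fun _ => norm_deriv_le_of_lipschitz hg)
  rw [← integral_const_mul, ← integral_add (hi hg) ((hi hf).const_mul c)]
  refine integral_congr_ae (ae_restrict_of_ae ?_)
  filter_upwards [hg.ae_differentiableAt_real, hf.ae_differentiableAt_real] with ξ h1 h2
  have h3 : deriv (fun s => g s + c * f s) ξ = deriv g ξ + c * deriv f ξ :=
    (h1.hasDerivAt.add (h2.hasDerivAt.const_mul c)).deriv
  rw [h3]
  ring

theorem rlLeft_add_smul {μ : ℝ} (hμ : μ < 1) {g f : ℝ → ℝ} {K K' K'' : ℝ≥0}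
    (hg : LipschitzWith K g) (hg0 : ∀ x, x ∉ Ioo (0 : ℝ) 1 → g x = 0)
    (hf : LipschitzWith K' f) (hf0 : ∀ x, x ∉ Ioo (0 : ℝ) 1 → f x = 0) (c : ℝ)
    (hgf : LipschitzWith K'' fun s => g s + c * f s) {x : ℝ} (hx : x ∈ Ioo (0 : ℝ) 1) :
    rlLeft μ 0 (fun s => g s + c * f s) x = rlLeft μ 0 g x + c * rlLeft μ 0 f x := by
  rw [rlLeft_eq hμ hgf (fun x hx => by rw [hg0 x hx, hf0 x hx, mul_zero, add_zero]) hx,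
    rlLeft_eq hμ hg hg0 hx, rlLeft_eq hμ hf hf0 hx,
    integral_mul_deriv_add_smul ((integrable_fracKer hμ).comp_sub_left x) hg hf]
  ring

theorem rlRight_add_smul {μ : ℝ} (hμ : μ < 1) {g f : ℝ → ℝ} {K K' K'' : ℝ≥0}
    (hg : LipschitzWith K g) (hg0 : ∀ x, x ∉ Ioo (0 : ℝ) 1 → g x = 0)
    (hf : LipschitzWith K' f) (hf0 : ∀ x, x ∉ Ioo (0 : ℝ) 1 → f x = 0) (c : ℝ)
    (hgf : LipschitzWith K'' fun s => g s + c * f s) {x : ℝ} (hx : x ∈ Ioo (0 : ℝ) 1) :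
    rlRight μ 1 (fun s => g s + c * f s) x = rlRight μ 1 g x + c * rlRight μ 1 f x := by
  rw [rlRight_eq hμ hgf (fun x hx => by rw [hg0 x hx, hf0 x hx, mul_zero, add_zero]) hx,
    rlRight_eq hμ hg hg0 hx, rlRight_eq hμ hf hf0 hx,
    integral_mul_deriv_add_smul ((integrable_fracKer hμ).comp_sub_right x) hg hf]
  ring

/-- The Lipschitz functions on the plane vanishing off `Ω`. It contains the finite element spaces,
and the energy form is well behaved on it. -/
def lipSpace : Submodule ℝ (ℝ × ℝ → ℝ) where
  carrier := {v | (∃ K : ℝ≥0, LipschitzWith K v) ∧ ∀ z, z ∉ Omega → v z = 0}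
  add_mem' := by
    rintro u v ⟨⟨K, hu⟩, hu0⟩ ⟨⟨K', hv⟩, hv0⟩
    exact ⟨⟨K + K', hu.add hv⟩, fun z hz => by simp [hu0 z hz, hv0 z hz]⟩
  zero_mem' := ⟨⟨0, LipschitzWith.const 0⟩, fun _ _ => rfl⟩
  smul_mem' := by
    rintro c v ⟨⟨K, hv⟩, hv0⟩
    exact ⟨⟨‖c‖₊ * K, (lipschitzWith_smul c).comp hv⟩, fun z hz => by simp [hv0 z hz]⟩

theorem continuous_of_mem_lipSpace {v : ℝ × ℝ → ℝ} (hv : v ∈ lipSpace) : Continuous v :=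
  hv.1.choose_spec.continuous

theorem comp_swap_mem_lipSpace {v : ℝ × ℝ → ℝ} (hv : v ∈ lipSpace) : v ∘ Prod.swap ∈ lipSpace := by
  obtain ⟨⟨K, hK⟩, h0⟩ := hv
  refine ⟨⟨K, LipschitzWith.of_dist_le_mul fun a b => ?_⟩, fun z hz => h0 _ fun h => hz ⟨h.2, h.1⟩⟩
  have := hK.dist_le_mul a.swap b.swap
  rwa [show dist a.swap b.swap = dist a b by simp [Prod.dist_eq, max_comm]] at this

theorem lipschitz_slice {v : ℝ × ℝ → ℝ} {K : ℝ≥0} (hK : LipschitzWith K v) (y : ℝ) :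
    LipschitzWith K fun s => v (s, y) :=
  LipschitzWith.of_dist_le_mul fun a b => by
    have := hK.dist_le_mul (a, y) (b, y)
    rwa [show dist (a, y) (b, y) = dist a b by simp [Prod.dist_eq]] at this

theorem slice_eq_zero {v : ℝ × ℝ → ℝ} (h0 : ∀ z, z ∉ Omega → v z = 0) (y : ℝ) :
    ∀ x, x ∉ Ioo (0 : ℝ) 1 → v (x, y) = 0 :=
  fun _ hx => h0 _ fun h => hx h.1

theorem measurableSet_Omega : MeasurableSet Omega := measurableSet_Ioo.prod measurableSet_Ioo

theorem isOpen_Omega : IsOpen Omega := isOpen_Ioo.prod isOpen_Ioo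

theorem restrict_Omega : (volume : Measure (ℝ × ℝ)).restrict Omega
    = (volume.restrict (Ioo (0 : ℝ) 1)).prod (volume.restrict (Ioo (0 : ℝ) 1)) := by
  rw [Omega, Measure.volume_eq_prod, Measure.prod_restrict]

instance : IsFiniteMeasure ((volume : Measure (ℝ × ℝ)).restrict Omega) := by
  rw [restrict_Omega]; infer_instance

theorem memLp_convolution_slice {k : ℝ → ℝ} (hkm : Measurable k) (hk : Integrable k)
    {v : ℝ × ℝ → ℝ} {K : ℝ≥0} (hv : LipschitzWith K v) :
    MemLp (fun z : ℝ × ℝ => ∫ ξ in Ioo (0 : ℝ) 1, k (z.1 - ξ) * deriv (fun s => v (s, z.2)) ξ)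
      2 (volume.restrict Omega) := by
  have hm : Measurable fun p : (ℝ × ℝ) × ℝ =>
      k (p.1.1 - p.2) * deriv (fun s => v (s, p.1.2)) p.2 := by
    refine (hkm.comp (by fun_prop)).mul ?_
    have h1 : Continuous (fun (y s : ℝ) => v (s, y)).uncurry :=
      hv.continuous.comp (by fun_prop)
    exact (measurable_deriv_with_param h1).comp
      (by fun_prop : Measurable fun p : (ℝ × ℝ) × ℝ => (p.1.2, p.2))
  refine MemLp.of_bound (hm.stronglyMeasurable.integral_prod_right'
    (ν := volume.restrict (Ioo (0 : ℝ) 1))).aestronglyMeasurable ((∫ t, ‖k t‖) * K)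
    (Filter.Eventually.of_forall fun z => ?_)
  have hi : Integrable fun ξ => ‖k (z.1 - ξ)‖ * K := (hk.comp_sub_left z.1).norm.mul_const _
  calc ‖∫ ξ in Ioo (0 : ℝ) 1, k (z.1 - ξ) * deriv (fun s => v (s, z.2)) ξ‖
      ≤ ∫ ξ in Ioo (0 : ℝ) 1, ‖k (z.1 - ξ)‖ * K := by
        refine norm_integral_le_of_norm_le hi.integrableOn (Filter.Eventually.of_forall fun ξ => ?_)
        rw [norm_mul]
        gcongr
        exact norm_deriv_le_of_lipschitz (lipschitz_slice hv z.2)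
    _ ≤ ∫ ξ, ‖k (z.1 - ξ)‖ * K :=
        setIntegral_le_integral hi (Filter.Eventually.of_forall fun ξ => by positivity)
    _ = _ := by rw [integral_mul_const, integral_sub_left_eq_self (fun ξ => ‖k ξ‖)]

theorem memLp_dxLeft {μ : ℝ} (hμ : μ < 1) {v : ℝ × ℝ → ℝ} (hv : v ∈ lipSpace) :
    MemLp (dxLeft μ v) 2 (volume.restrict Omega) := by
  obtain ⟨⟨K, hK⟩, h0⟩ := hv
  refine ((memLp_convolution_slice (measurable_fracKer μ) (integrable_fracKer hμ) hK).const_mul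
    (1 / Real.Gamma (1 - μ))).ae_eq ?_
  filter_upwards [ae_restrict_mem measurableSet_Omega] with z hz
  exact (rlLeft_eq hμ (lipschitz_slice hK z.2) (slice_eq_zero h0 z.2) hz.1).symm

theorem memLp_dxRight {μ : ℝ} (hμ : μ < 1) {v : ℝ × ℝ → ℝ} (hv : v ∈ lipSpace) :
    MemLp (dxRight μ v) 2 (volume.restrict Omega) := by
  obtain ⟨⟨K, hK⟩, h0⟩ := hv
  refine ((memLp_convolution_slice (k := fun t => fracKer μ (-t))
    ((measurable_fracKer μ).comp measurable_neg) (integrable_fracKer hμ).comp_neg hK).const_mul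
    ((-1) / Real.Gamma (1 - μ))).ae_eq ?_
  filter_upwards [ae_restrict_mem measurableSet_Omega] with z hz
  simp only [neg_sub]
  exact (rlRight_eq hμ (lipschitz_slice hK z.2) (slice_eq_zero h0 z.2) hz.1).symm

theorem dxLeft_add_smul {μ : ℝ} (hμ : μ < 1) {u v : ℝ × ℝ → ℝ} (hu : u ∈ lipSpace)
    (hv : v ∈ lipSpace) (c : ℝ) {z : ℝ × ℝ} (hz : z ∈ Omega) :
    dxLeft μ (u + c • v) z = dxLeft μ u z + c * dxLeft μ v z := by
  obtain ⟨K'', h⟩ := (lipSpace.add_mem hu (lipSpace.smul_mem c hv)).1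
  obtain ⟨⟨K, hK⟩, h0⟩ := hu
  obtain ⟨⟨K', hK'⟩, h0'⟩ := hv
  exact rlLeft_add_smul hμ (lipschitz_slice hK z.2) (slice_eq_zero h0 z.2)
    (lipschitz_slice hK' z.2) (slice_eq_zero h0' z.2) c (lipschitz_slice h z.2) hz.1

theorem dxRight_add_smul {μ : ℝ} (hμ : μ < 1) {u v : ℝ × ℝ → ℝ} (hu : u ∈ lipSpace)
    (hv : v ∈ lipSpace) (c : ℝ) {z : ℝ × ℝ} (hz : z ∈ Omega) :
    dxRight μ (u + c • v) z = dxRight μ u z + c * dxRight μ v z := by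
  obtain ⟨K'', h⟩ := (lipSpace.add_mem hu (lipSpace.smul_mem c hv)).1
  obtain ⟨⟨K, hK⟩, h0⟩ := hu
  obtain ⟨⟨K', hK'⟩, h0'⟩ := hv
  exact rlRight_add_smul hμ (lipschitz_slice hK z.2) (slice_eq_zero h0 z.2)
    (lipschitz_slice hK' z.2) (slice_eq_zero h0' z.2) c (lipschitz_slice h z.2) hz.1

theorem ip_comm (u v : ℝ × ℝ → ℝ) : ip u v = ip v u := by
  simp only [ip, mul_comm]

theorem ip_swap (u v : ℝ × ℝ → ℝ) : ip (u ∘ Prod.swap) (v ∘ Prod.swap) = ip u v := by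
  have h := (Measure.measurePreserving_swap (μ := volume.restrict (Ioo (0 : ℝ) 1))
    (ν := volume.restrict (Ioo (0 : ℝ) 1))).integral_comp
    MeasurableEquiv.prodComm.measurableEmbedding (fun z => u z * v z)
  rw [ip, ip, restrict_Omega]
  exact h

/-- The form `(₀D_x^μ u, ₓD_1^μ v)`. The forms in the variable `y` are obtained from it by swapping
the coordinates of `u` and `v`. -/
noncomputable def xForm (μ : ℝ) (u v : ℝ × ℝ → ℝ) : ℝ := ip (dxLeft μ u) (dxRight μ v)

theorem xForm_add_smul_left {μ : ℝ} (hμ : μ < 1) {u v w : ℝ × ℝ → ℝ} (hu : u ∈ lipSpace)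
    (hv : v ∈ lipSpace) (hw : w ∈ lipSpace) (c : ℝ) :
    xForm μ (u + c • v) w = xForm μ u w + c * xForm μ v w := by
  have i1 := (memLp_dxLeft hμ hu).integrable_mul (memLp_dxRight hμ hw)
  have i2 := (memLp_dxLeft hμ hv).integrable_mul (memLp_dxRight hμ hw)
  rw [xForm, xForm, xForm, ip, ip, ip, ← integral_const_mul]
  refine Eq.trans ?_ (integral_add i1 (i2.const_mul c))
  refine setIntegral_congr_fun measurableSet_Omega fun z hz => ?_
  simp only [dxLeft_add_smul hμ hu hv c hz]
  ring

theorem xForm_add_smul_right {μ : ℝ} (hμ : μ < 1) {u v w : ℝ × ℝ → ℝ} (hu : u ∈ lipSpace)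
    (hv : v ∈ lipSpace) (hw : w ∈ lipSpace) (c : ℝ) :
    xForm μ w (u + c • v) = xForm μ w u + c * xForm μ w v := by
  have i1 := (memLp_dxLeft hμ hw).integrable_mul (memLp_dxRight hμ hu)
  have i2 := (memLp_dxLeft hμ hw).integrable_mul (memLp_dxRight hμ hv)
  rw [xForm, xForm, xForm, ip, ip, ip, ← integral_const_mul]
  refine Eq.trans ?_ (integral_add i1 (i2.const_mul c))
  refine setIntegral_congr_fun measurableSet_Omega fun z hz => ?_
  simp only [dxRight_add_smul hμ hu hv c hz]
  ring

theorem wForm_eq (α β : ℝ) (u v : ℝ × ℝ → ℝ) : wForm α β u v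
    = rieszConst α * (xForm (α / 2) u v + xForm (α / 2) v u)
      + rieszConst β * (xForm (β / 2) (u ∘ Prod.swap) (v ∘ Prod.swap)
        + xForm (β / 2) (v ∘ Prod.swap) (u ∘ Prod.swap)) := by
  have h : ∀ u v : ℝ × ℝ → ℝ, ip (dyLeft (β / 2) u) (dyRight (β / 2) v)
      = xForm (β / 2) (u ∘ Prod.swap) (v ∘ Prod.swap) := fun u v =>
    ip_swap (dxLeft (β / 2) (u ∘ Prod.swap)) (dxRight (β / 2) (v ∘ Prod.swap))
  rw [wForm, ip_comm (dxRight _ _), ip_comm (dyRight _ _), h, h]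
  simp only [xForm]
  ring

theorem wForm_comm (α β : ℝ) (u v : ℝ × ℝ → ℝ) : wForm α β u v = wForm α β v u := by
  rw [wForm_eq, wForm_eq]; ring

theorem wForm_add_smul_left {α β : ℝ} (hα : α < 2) (hβ : β < 2) {u v w : ℝ × ℝ → ℝ}
    (hu : u ∈ lipSpace) (hv : v ∈ lipSpace) (hw : w ∈ lipSpace) (c : ℝ) :
    wForm α β (u + c • v) w = wForm α β u w + c * wForm α β v w := by
  have hα' : α / 2 < 1 := by linarith
  have hβ' : β / 2 < 1 := by linarith
  have e : (u + c • v) ∘ Prod.swap = u ∘ Prod.swap + c • (v ∘ Prod.swap) := rfl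
  simp only [wForm_eq, e]
  rw [xForm_add_smul_left hα' hu hv hw, xForm_add_smul_right hα' hu hv hw,
    xForm_add_smul_left hβ' (comp_swap_mem_lipSpace hu) (comp_swap_mem_lipSpace hv)
      (comp_swap_mem_lipSpace hw),
    xForm_add_smul_right hβ' (comp_swap_mem_lipSpace hu) (comp_swap_mem_lipSpace hv)
      (comp_swap_mem_lipSpace hw)]
  ring

theorem memLp_of_mem_lipSpace {v : ℝ × ℝ → ℝ} (hv : v ∈ lipSpace) :
    MemLp v 2 (volume.restrict Omega) := by
  obtain ⟨⟨K, hK⟩, h0⟩ := hv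
  exact MemLp.of_bound hK.continuous.aestronglyMeasurable K
    (Filter.Eventually.of_forall fun z =>
      norm_le_of_lipschitz_of_zero_off (lipschitz_slice hK z.2) (slice_eq_zero h0 z.2) z.1)

theorem exists_coercive_xForm {α : ℝ} (hα1 : 1 < α) (hα2 : α < 2) : ∃ c : ℝ, 0 < c ∧
    ∀ v ∈ lipSpace, c * ip v v ≤ -xForm (α / 2) v v := by
  obtain ⟨c, hc, h⟩ := exists_coercive_rl hα1 hα2
  refine ⟨c, hc, fun v hv => ?_⟩
  have hμ : α / 2 < 1 := by linarith
  have i1 := (memLp_dxLeft hμ hv).integrable_mul (memLp_dxRight hμ hv)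
  have i2 := (memLp_of_mem_lipSpace hv).integrable_mul (memLp_of_mem_lipSpace hv)
  obtain ⟨⟨K, hK⟩, h0⟩ := hv
  rw [xForm, ip, ip]
  rw [restrict_Omega] at i1 i2 ⊢
  have e1 := integral_prod_symm _ i1
  have e2 := integral_prod_symm _ i2
  simp only [Pi.mul_apply] at e1 e2
  rw [e1, e2, ← integral_const_mul, ← integral_neg]
  refine integral_mono (i2.integral_prod_right.const_mul c) i1.integral_prod_right.neg fun y => ?_
  have := h (fun s => v (s, y)) K (lipschitz_slice hK y) (slice_eq_zero h0 y)
  simp only [sq] at this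
  exact this

theorem rieszConst_neg {α : ℝ} (hα1 : 1 < α) (hα2 : α < 2) : rieszConst α < 0 := by
  have hpi := Real.pi_pos
  have : Real.cos (α * Real.pi / 2) < 0 :=
    Real.cos_neg_of_pi_div_two_lt_of_lt (by nlinarith) (by nlinarith)
  rw [rieszConst]
  exact div_neg_of_pos_of_neg one_pos (by linarith)

theorem ip_self_nonneg (v : ℝ × ℝ → ℝ) : 0 ≤ ip v v :=
  integral_nonneg fun _ => mul_self_nonneg _

theorem exists_coercive_wForm {α β : ℝ} (hα1 : 1 < α) (hα2 : α < 2) (hβ1 : 1 < β) (hβ2 : β < 2) :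
    ∃ c : ℝ, 0 < c ∧ ∀ v ∈ lipSpace, c * ip v v ≤ wForm α β v v := by
  obtain ⟨c, hc, h⟩ := exists_coercive_xForm hα1 hα2
  obtain ⟨c', hc', h'⟩ := exists_coercive_xForm hβ1 hβ2
  have r1 := rieszConst_neg hα1 hα2
  have r2 := rieszConst_neg hβ1 hβ2
  refine ⟨-rieszConst α * (2 * c), by nlinarith, fun v hv => ?_⟩
  have h1 := h v hv
  have h2 := (mul_nonneg hc'.le (ip_self_nonneg _)).trans (h' _ (comp_swap_mem_lipSpace hv))
  rw [wForm_eq]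
  nlinarith

/-- The map sending a function in `lipSpace` to its class in `L²(Ω)`. -/
noncomputable def toL2 : lipSpace →ₗ[ℝ] Lp ℝ 2 ((volume : Measure (ℝ × ℝ)).restrict Omega) where
  toFun v := (memLp_of_mem_lipSpace v.2).toLp
  map_add' _ _ := rfl
  map_smul' _ _ := rfl

theorem inner_toLp {u v : ℝ × ℝ → ℝ} (hu : MemLp u 2 (volume.restrict Omega))
    (hv : MemLp v 2 (volume.restrict Omega)) : inner ℝ hu.toLp hv.toLp = ip u v := by
  rw [L2.inner_def, ip]
  refine integral_congr_ae ?_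
  filter_upwards [hu.coeFn_toLp, hv.coeFn_toLp] with z h1 h2
  rw [h1, h2]
  simp [mul_comm]

theorem norm_toLp {u : ℝ × ℝ → ℝ} (hu : MemLp u 2 (volume.restrict Omega)) :
    ‖hu.toLp‖ = l2norm u := by
  rw [l2norm, ← inner_toLp hu hu, real_inner_self_eq_norm_sq, Real.sqrt_sq (norm_nonneg _)]

theorem toL2_injective : Function.Injective toL2 := by
  rw [← LinearMap.ker_eq_bot, LinearMap.ker_eq_bot']
  intro v hv
  have h1 : (v : ℝ × ℝ → ℝ) =ᵐ[volume.restrict Omega] fun _ => 0 := by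
    have h2 := (memLp_of_mem_lipSpace v.2).coeFn_toLp
    rw [show (memLp_of_mem_lipSpace v.2).toLp = 0 from hv] at h2
    exact h2.symm.trans (Lp.coeFn_zero _ _ _)
  have h3 := Measure.eqOn_open_of_ae_eq h1 isOpen_Omega
    (continuous_of_mem_lipSpace v.2).continuousOn continuousOn_const
  ext z
  by_cases hz : z ∈ Omega
  · exact h3 hz
  · exact v.2.2 z hz

/-- The energy form as an inner product on `lipSpace`. It is definite since it controls the `L²`
norm and the functions are continuous. -/
@[reducible] noncomputable def energyCore {α β : ℝ} (hα1 : 1 < α) (hα2 : α < 2) (hβ1 : 1 < β)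
    (hβ2 : β < 2) : InnerProductSpace.Core ℝ lipSpace where
  inner u v := wForm α β u v
  conj_inner_symm u v := wForm_comm α β v u
  re_inner_nonneg v := by
    obtain ⟨c, hc, h⟩ := exists_coercive_wForm hα1 hα2 hβ1 hβ2
    exact (mul_nonneg hc.le (ip_self_nonneg _)).trans (h _ v.2)
  add_left u v w := by
    have := wForm_add_smul_left hα2 hβ2 u.2 v.2 w.2 1
    simpa using this
  smul_left u v r := by
    have h1 := wForm_add_smul_left hα2 hβ2 lipSpace.zero_mem u.2 v.2 r
    have h2 := wForm_add_smul_left hα2 hβ2 lipSpace.zero_mem lipSpace.zero_mem v.2 1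
    simp only [zero_add, smul_zero, one_mul, left_eq_add] at h1 h2
    rw [h2, zero_add] at h1
    exact h1
  definite v hv := by
    obtain ⟨c, hc, h⟩ := exists_coercive_wForm hα1 hα2 hβ1 hβ2
    have h1 := h _ v.2
    have h2 : wForm α β (v : ℝ × ℝ → ℝ) v = 0 := hv
    have h3 : ip (v : ℝ × ℝ → ℝ) v = 0 := by
      have := ip_self_nonneg (v : ℝ × ℝ → ℝ)
      nlinarith
    refine toL2_injective ?_
    rw [map_zero, ← norm_eq_zero]
    change ‖(memLp_of_mem_lipSpace v.2).toLp‖ = 0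
    rw [norm_toLp, l2norm, h3, Real.sqrt_zero]

/-! ### The finite element space -/

/-- A function that is Lipschitz on each of finitely many closed sets covering the space is
Lipschitz: along a segment, at every point one of the sets accumulates from the right. -/
theorem lipschitzWith_of_finite_closed_cover {E ι : Type*} [NormedAddCommGroup E] [NormedSpace ℝ E]
    [Finite ι] {C : ι → Set E} (hC : ∀ i, IsClosed (C i)) (hcov : ∀ x, ∃ i, x ∈ C i)
    {v : E → ℝ} (hv : Continuous v) {K : ℝ≥0} (hK : ∀ i, LipschitzOnWith K v (C i)) :
    LipschitzWith K v := by
  have key : ∀ a b, v b - v a ≤ K * ‖b - a‖ := by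
    intro a b
    set γ : ℝ → E := fun t => a + t • (b - a) with hγ
    have hγc : Continuous γ := by fun_prop
    have hslope : ∀ x ∈ Ico (0 : ℝ) 1, ∀ r, K * ‖b - a‖ < r →
        ∃ᶠ z in 𝓝[>] x, slope (fun t => v (γ t) - v a) x z < r := by
      intro x _ r hr
      -- one of the finitely many pieces accumulates at `x` from the right
      obtain ⟨i, hi⟩ : ∃ i, ∃ᶠ z in 𝓝[>] x, γ z ∈ C i := by
        by_contra! h
        obtain ⟨z, hz⟩ := (Filter.eventually_all.2 h).exists
        obtain ⟨i, hi⟩ := hcov (γ z)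
        exact hz i hi
      have hx : γ x ∈ C i := (hC i).mem_of_frequently_of_tendsto hi
        (hγc.continuousAt.tendsto.mono_left nhdsWithin_le_nhds)
      refine (hi.and_eventually self_mem_nhdsWithin).mono fun z hz => lt_of_le_of_lt ?_ hr
      have hzx : 0 < z - x := sub_pos.2 hz.2
      have h1 := (hK i).dist_le_mul _ hz.1 _ hx
      have h2 : γ z - γ x = (z - x) • (b - a) := by
        simp only [hγ, sub_smul]; abel
      rw [dist_eq_norm, dist_eq_norm, h2, norm_smul, Real.norm_of_nonneg hzx.le] at h1
      rw [slope_def_field, div_le_iff₀ hzx]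
      have h3 := (le_abs_self _).trans h1
      linarith
    have h := image_le_of_liminf_slope_right_le_deriv_boundary (a := 0) (b := 1)
      (f := fun t => v (γ t) - v a) (B := fun t => K * ‖b - a‖ * t)
      (B' := fun _ => K * ‖b - a‖) (by fun_prop) (by simp [hγ]) (by fun_prop)
      (fun x _ => by simpa using ((hasDerivAt_id x).const_mul (K * ‖b - a‖)).hasDerivWithinAt)
      hslope (right_mem_Icc.2 zero_le_one)
    simpa [hγ] using h
  refine LipschitzWith.of_dist_le_mul fun a b => ?_
  rw [Real.dist_eq, abs_sub_le_iff, dist_eq_norm]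
  exact ⟨key b a, by rw [norm_sub_rev]; exact key a b⟩

theorem eval_eq_sum_monomials (p : MvPolynomial (Fin 2) ℝ) (z : ℝ × ℝ) :
    MvPolynomial.eval ![z.1, z.2] p
      = ∑ e ∈ p.support, MvPolynomial.coeff e p * (z.1 ^ e 0 * z.2 ^ e 1) := by
  rw [MvPolynomial.eval_eq']
  simp [Fin.prod_univ_two]

theorem exists_lipschitzOnWith_eval (p : MvPolynomial (Fin 2) ℝ) {C : Set (ℝ × ℝ)}
    (hC : IsCompact C) :
    ∃ K : ℝ≥0, LipschitzOnWith K (fun z : ℝ × ℝ => MvPolynomial.eval ![z.1, z.2] p) C := by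
  have h : ContDiff ℝ 1 fun z : ℝ × ℝ => MvPolynomial.eval ![z.1, z.2] p := by
    simp only [eval_eq_sum_monomials]
    refine ContDiff.sum fun e _ => ?_
    fun_prop
  exact h.locallyLipschitz.locallyLipschitzOn.exists_lipschitzOnWith_of_compact hC

theorem volume_convexHull_eq_zero {s : Finset (ℝ × ℝ)}
    (hs : AffineIndependent ℝ ((↑) : s → ℝ × ℝ)) (hcard : s.card ≠ 3) :
    volume (convexHull ℝ (s : Set (ℝ × ℝ))) = 0 := by
  refine measure_mono_null (convexHull_subset_affineSpan _)
    (Measure.addHaar_affineSubspace _ _ fun h => hcard ?_)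
  have h1 := hs.affineSpan_eq_top_iff_card_eq_finrank_add_one.1 (by simpa using h)
  simpa using h1

/-- Every point of `Ω` lies in an element with three vertices: the points outside these form an open
subset of `Ω` covered by the remaining faces, which are null sets. -/
theorem Omega_subset_triangles {𝒯 : Geometry.SimplicialComplex ℝ (ℝ × ℝ)} (h : IsTriangulation 𝒯)
    {z : ℝ × ℝ} (hz : z ∈ Omega) :
    ∃ s ∈ 𝒯.faces, s.card = 3 ∧ z ∈ convexHull ℝ (s : Set (ℝ × ℝ)) := by
  set C : Set (ℝ × ℝ) := ⋃ s ∈ {s ∈ 𝒯.faces | s.card = 3}, convexHull ℝ (s : Set (ℝ × ℝ)) with hCdef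
  have hCclosed : IsClosed C := Set.Finite.isClosed_biUnion (h.finite.subset (sep_subset _ _))
    fun s _ => (s.finite_toSet.isCompact_convexHull ℝ).isClosed
  have hnull : volume (Omega \ C) = 0 := by
    refine measure_mono_null (t := ⋃ s ∈ {s ∈ 𝒯.faces | s.card ≠ 3},
      convexHull ℝ (s : Set (ℝ × ℝ))) ?_ ?_
    · rintro x ⟨hx, hxC⟩
      have hx' : x ∈ 𝒯.space := by
        rw [h.space_eq]
        exact ⟨Ioo_subset_Icc_self hx.1, Ioo_subset_Icc_self hx.2⟩
      obtain ⟨s, hs, hxs⟩ := 𝒯.mem_space_iff.1 hx'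
      refine mem_biUnion (x := s) ⟨hs, fun hcard => hxC ?_⟩ hxs
      exact mem_biUnion (x := s) ⟨hs, hcard⟩ hxs
    · rw [measure_biUnion_null_iff (h.finite.subset (sep_subset _ _)).countable]
      exact fun s hs => volume_convexHull_eq_zero (𝒯.indep hs.1) hs.2
  have hempty : Omega \ C = ∅ :=
    ((isOpen_Omega.sdiff hCclosed).measure_eq_zero_iff volume).1 hnull
  have hzC : z ∈ C := by
    by_contra hzC
    exact (hempty ▸ (⟨hz, hzC⟩ : z ∈ Omega \ C) : z ∈ (∅ : Set (ℝ × ℝ)))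
  obtain ⟨s, hs, hzs⟩ := mem_iUnion₂.1 hzC
  exact ⟨s, hs.1, hs.2, hzs⟩

theorem feSpace_subset_lipSpace {α β : ℝ} {𝒯 : Geometry.SimplicialComplex ℝ (ℝ × ℝ)}
    (h : IsTriangulation 𝒯) (m : ℕ) : feSpace α β 𝒯 m ⊆ lipSpace := by
  rintro v ⟨hvc, hv0, -, -, hv⟩
  refine ⟨?_, hv0⟩
  let I := Option {s : Finset (ℝ × ℝ) // s ∈ 𝒯.faces ∧ s.card = 3}
  have : Finite {s : Finset (ℝ × ℝ) // s ∈ 𝒯.faces ∧ s.card = 3} :=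
    (h.finite.subset (sep_subset _ _)).to_subtype
  have hfin : Finite I := inferInstance
  let C : I → Set (ℝ × ℝ) := fun i => i.elim Omegaᶜ fun s => convexHull ℝ (s.1 : Set (ℝ × ℝ))
  have hC : ∀ i, IsClosed (C i) := by
    rintro (_ | s)
    · exact isOpen_Omega.isClosed_compl
    · exact (s.1.finite_toSet.isCompact_convexHull ℝ).isClosed
  have hcov : ∀ z, ∃ i, z ∈ C i := by
    intro z
    by_cases hz : z ∈ Omega
    · obtain ⟨s, hs, hs3, hzs⟩ := Omega_subset_triangles h hz
      exact ⟨some ⟨s, hs, hs3⟩, hzs⟩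
    · exact ⟨none, hz⟩
  have hlip : ∀ i, ∃ K : ℝ≥0, LipschitzOnWith K v (C i) := by
    rintro (_ | s)
    · refine ⟨0, fun x hx y hy => ?_⟩
      rw [hv0 x hx, hv0 y hy]
      simp
    · obtain ⟨p, -, hp⟩ := hv s.1 s.2.1 s.2.2
      obtain ⟨K, hK⟩ := exists_lipschitzOnWith_eval p (s.1.finite_toSet.isCompact_convexHull ℝ)
      refine ⟨K, fun x hx y hy => ?_⟩
      rw [hp x hx, hp y hy]
      exact hK hx hy
  choose K hK using hlip
  obtain ⟨M, hM⟩ := Finite.exists_le K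
  exact ⟨M, lipschitzWith_of_finite_closed_cover hC hcov hvc fun i => (hK i).weaken (hM i)⟩

/-- Assigning to each point of `Ω` one triangle containing it, the finite element functions are
combinations of the finitely many monomials cut off to the resulting pieces. -/
theorem finiteDimensional_span_feSpace {α β : ℝ} {𝒯 : Geometry.SimplicialComplex ℝ (ℝ × ℝ)}
    (h : IsTriangulation 𝒯) (m : ℕ) :
    FiniteDimensional ℝ (Submodule.span ℝ (feSpace α β 𝒯 m)) := by
  classical
  have hex : ∀ z : ℝ × ℝ, ∃ s : Finset (ℝ × ℝ), z ∈ Omega → s ∈ 𝒯.faces ∧ s.card = 3 ∧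
      z ∈ convexHull ℝ (s : Set (ℝ × ℝ)) := by
    intro z
    by_cases hz : z ∈ Omega
    · obtain ⟨s, hs⟩ := Omega_subset_triangles h hz
      exact ⟨s, fun _ => hs⟩
    · exact ⟨∅, fun h => absurd h hz⟩
  choose S hS using hex
  let b : Finset (ℝ × ℝ) → ℕ × ℕ → ℝ × ℝ → ℝ := fun s e =>
    indicator {z | z ∈ Omega ∧ S z = s} fun z => z.1 ^ e.1 * z.2 ^ e.2
  have hb : ∀ s e z, b s e z = if z ∈ Omega ∧ S z = s then z.1 ^ e.1 * z.2 ^ e.2 else 0 :=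
    fun s e z => indicator_apply _ _ _
  set B : Set (ℝ × ℝ → ℝ) := image2 b 𝒯.faces (Iic m ×ˢ Iic m) with hB
  have hBfin : B.Finite := h.finite.image2 _ ((finite_Iic m).prod (finite_Iic m))
  have hle : Submodule.span ℝ (feSpace α β 𝒯 m) ≤ Submodule.span ℝ B := by
    rw [Submodule.span_le]
    rintro v ⟨-, hv0, -, -, hv⟩
    have hv' : ∀ s : Finset (ℝ × ℝ), ∃ p : MvPolynomial (Fin 2) ℝ, s ∈ 𝒯.faces → s.card = 3 →
        p.totalDegree ≤ m ∧ ∀ z ∈ convexHull ℝ (s : Set (ℝ × ℝ)),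
          v z = MvPolynomial.eval ![z.1, z.2] p := by
      intro s
      by_cases hs : s ∈ 𝒯.faces ∧ s.card = 3
      · obtain ⟨p, hp⟩ := hv s hs.1 hs.2
        exact ⟨p, fun _ _ => hp⟩
      · exact ⟨0, fun h1 h2 => absurd ⟨h1, h2⟩ hs⟩
    choose p hp using hv'
    have hvsum : v = ∑ s ∈ h.finite.toFinset.filter (fun s => s.card = 3),
        ∑ e ∈ (p s).support, MvPolynomial.coeff e (p s) • b s (e 0, e 1) := by
      ext z
      simp only [Finset.sum_apply, Pi.smul_apply, smul_eq_mul]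
      by_cases hz : z ∈ Omega
      · obtain ⟨h1, h2, h3⟩ := hS z hz
        rw [Finset.sum_eq_single (S z)]
        · rw [(hp (S z) h1 h2).2 z h3, eval_eq_sum_monomials]
          refine Finset.sum_congr rfl fun e _ => ?_
          rw [hb, if_pos ⟨hz, rfl⟩]
        · intro s _ hs
          refine Finset.sum_eq_zero fun e _ => ?_
          rw [hb, if_neg (fun h' => hs h'.2.symm), mul_zero]
        · intro h'
          exact absurd (Finset.mem_filter.2 ⟨h.finite.mem_toFinset.2 h1, h2⟩) h'
      · rw [hv0 z hz]
        refine (Finset.sum_eq_zero fun s _ => Finset.sum_eq_zero fun e _ => ?_).symm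
        rw [hb, if_neg (fun h' => hz h'.1), mul_zero]
    rw [hvsum]
    refine Submodule.sum_mem _ fun s hs => Submodule.sum_mem _ fun e he => Submodule.smul_mem _ _
      (Submodule.subset_span ?_)
    rw [Finset.mem_filter, h.finite.mem_toFinset] at hs
    have hdeg := (MvPolynomial.le_totalDegree he).trans (hp s hs.1 hs.2).1
    rw [Finsupp.sum_fintype _ _ (fun _ => rfl), Fin.sum_univ_two] at hdeg
    exact ⟨s, hs.1, (e 0, e 1), ⟨by simp; omega, by simp; omega⟩, rfl⟩
  have : FiniteDimensional ℝ (Submodule.span ℝ B) := FiniteDimensional.span_of_finite ℝ hBfin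
  exact Submodule.finiteDimensional_of_le hle

/-! ### The energy space -/

/-- The fractional orders `α` and `β` lie strictly between `1` and `2`. -/
class AdmissibleOrders (α β : ℝ) : Prop where
  one_lt_left : 1 < α
  left_lt_two : α < 2
  one_lt_right : 1 < β
  right_lt_two : β < 2

/-- A copy of `lipSpace` carrying the inner product `wForm α β` instead of the topology of pointwise
convergence inherited from the function space. -/
def EnergySpace (_α _β : ℝ) : Type := lipSpace

namespace EnergySpace

variable {α β : ℝ}

noncomputable instance : AddCommGroup (EnergySpace α β) := inferInstanceAs (AddCommGroup lipSpace)

noncomputable instance : Module ℝ (EnergySpace α β) := inferInstanceAs (Module ℝ lipSpace)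

/-- The underlying function of an element of the energy space. -/
noncomputable def toFun : EnergySpace α β →ₗ[ℝ] (ℝ × ℝ → ℝ) := lipSpace.subtype

/-- The class in `L²(Ω)` of an element of the energy space. -/
noncomputable def toLp : EnergySpace α β →ₗ[ℝ] Lp ℝ 2 ((volume : Measure (ℝ × ℝ)).restrict Omega) :=
  toL2

variable (α β) in
/-- The element of the energy space given by a function in `lipSpace`. -/
def ofMem (v : ℝ × ℝ → ℝ) (hv : v ∈ lipSpace) : EnergySpace α β := (⟨v, hv⟩ : lipSpace)

variable (α β) in
open Classical in
/-- The element of the energy space given by a function; it is `0` if the function is not in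
`lipSpace`. -/
noncomputable def lift (v : ℝ × ℝ → ℝ) : EnergySpace α β :=
  if hv : v ∈ lipSpace then ofMem α β v hv else 0

theorem toFun_mem (x : EnergySpace α β) : toFun x ∈ lipSpace :=
  Subtype.property (p := (· ∈ lipSpace)) x

theorem toFun_injective : Function.Injective (toFun : EnergySpace α β →ₗ[ℝ] _) :=
  lipSpace.injective_subtype

theorem toLp_injective : Function.Injective (toLp : EnergySpace α β →ₗ[ℝ] _) := toL2_injective

theorem toFun_lift {v : ℝ × ℝ → ℝ} (hv : v ∈ lipSpace) : toFun (lift α β v) = v := by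
  rw [lift, dif_pos hv]; rfl

theorem toLp_eq (x : EnergySpace α β) : toLp x = (memLp_of_mem_lipSpace (toFun_mem x)).toLp := rfl

theorem norm_toLp_eq (x : EnergySpace α β) : ‖toLp x‖ = l2norm (toFun x) := by
  rw [toLp_eq, norm_toLp]

variable [h : AdmissibleOrders α β]

noncomputable instance : InnerProductSpace.Core ℝ (EnergySpace α β) :=
  energyCore h.one_lt_left h.left_lt_two h.one_lt_right h.right_lt_two

noncomputable instance : NormedAddCommGroup (EnergySpace α β) :=
  InnerProductSpace.Core.toNormedAddCommGroup (𝕜 := ℝ)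

noncomputable instance : InnerProductSpace ℝ (EnergySpace α β) :=
  InnerProductSpace.ofCore inferInstance

theorem inner_eq (x y : EnergySpace α β) : inner ℝ x y = wForm α β (toFun x) (toFun y) := rfl

theorem norm_sq_eq (x : EnergySpace α β) : ‖x‖ ^ 2 = wForm α β (toFun x) (toFun x) := by
  rw [← real_inner_self_eq_norm_sq, inner_eq]

variable (α β) in
theorem exists_norm_toLp_le :
    ∃ C : ℝ, 0 < C ∧ ∀ x : EnergySpace α β, ‖toLp x‖ ≤ C * ‖x‖ := by
  obtain ⟨c, hc, hcoer⟩ :=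
    exists_coercive_wForm h.one_lt_left h.left_lt_two h.one_lt_right h.right_lt_two
  refine ⟨Real.sqrt (1 / c), by positivity, fun x => ?_⟩
  have h1 := hcoer _ (toFun_mem x)
  refine (sq_le_sq₀ (norm_nonneg _) (by positivity)).1 ?_
  rw [mul_pow, Real.sq_sqrt (by positivity), norm_sq_eq, toLp_eq, ← real_inner_self_eq_norm_sq,
    inner_toLp, one_div_mul_eq_div, le_div_iff₀ hc, mul_comm]
  exact h1

end EnergySpace

open Classical in
/-- The class in `L²(Ω)` of a function; it is `0` if the function is not square integrable. -/
noncomputable def l2Class (f : ℝ × ℝ → ℝ) : Lp ℝ 2 ((volume : Measure (ℝ × ℝ)).restrict Omega) :=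
  if hf : MemLp f 2 (volume.restrict Omega) then hf.toLp else 0

theorem l2Class_eq {f : ℝ × ℝ → ℝ} (hf : MemLp f 2 (volume.restrict Omega)) :
    l2Class f = hf.toLp := dif_pos hf

theorem norm_l2Class {f : ℝ × ℝ → ℝ} (hf : MemLp f 2 (volume.restrict Omega)) :
    ‖l2Class f‖ = l2norm f := by rw [l2Class_eq hf, norm_toLp]

theorem norm_l2Class_sub {f g : ℝ × ℝ → ℝ} (hf : MemLp f 2 (volume.restrict Omega))
    (hg : MemLp g 2 (volume.restrict Omega)) : ‖l2Class f - l2Class g‖ = l2norm (f - g) := by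
  rw [l2Class_eq hf, l2Class_eq hg, ← MemLp.toLp_sub, norm_toLp]

/-! ### The scheme in the energy space -/

section Transfer

variable {α β : ℝ} [h : AdmissibleOrders α β]

open EnergySpace

theorem step_mul (T : ℝ) {N : ℕ} (hN : 1 ≤ N) : (N : ℝ) * step T N = T := by
  have : (N : ℝ) ≠ 0 := by positivity
  rw [step]; field_simp

theorem step_nonneg {T : ℝ} (hT : 0 < T) (N : ℕ) : 0 ≤ step T N := by rw [step]; positivity

theorem mul_step_mem {T : ℝ} (hT : 0 < T) {N n : ℕ} (hN : 1 ≤ N) (hn : n ≤ N) :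
    (n : ℝ) * step T N ∈ Icc 0 T := by
  have h0 := step_nonneg hT N
  refine ⟨by positivity, ?_⟩
  calc (n : ℝ) * step T N ≤ N * step T N := by gcongr
    _ = T := step_mul T hN

/-- The scheme in a set `X` of functions, as a scheme in the subspace of the energy space spanned by
`X`. Passing to the span uses that the equations are linear in the test function. -/
theorem IsEulerGalerkin.lift {T : ℝ} {N : ℕ} {f : ℝ → ℝ × ℝ → ℝ} {X : Set (ℝ × ℝ → ℝ)}
    {u : ℕ → ℝ × ℝ → ℝ} (hu : IsEulerGalerkin α β T N f X u) (hX : X ⊆ lipSpace) (hT : 0 < T)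
    (hN : 1 ≤ N) (hf : ∀ t ∈ Icc (0 : ℝ) T, MemLp (f t) 2 (volume.restrict Omega)) :
    IsEulerScheme (toLp : EnergySpace α β →ₗ[ℝ] _) (step T N) N
      (fun n => l2Class (f (n * step T N))) (Submodule.span ℝ (toFun ⁻¹' X))
      (fun n => EnergySpace.lift α β (u n)) := by
  have hlift : ∀ n ≤ N, toFun (EnergySpace.lift α β (u n)) = u n := fun n hn =>
    toFun_lift (hX (hu.1 n hn))
  refine ⟨fun n hn => Submodule.subset_span ?_, fun n hn v hv => ?_⟩
  · rw [mem_preimage, hlift n hn]; exact hu.1 n hn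
  · induction hv using Submodule.span_induction with
    | mem v hv =>
      have h1 := hu.2 n hn _ hv
      have hF := hf _ (mul_step_mem hT hN hn)
      simp only [l2Class_eq hF, toLp_eq, inner_toLp, inner_eq, hlift n hn.le, hlift (n + 1) hn]
      exact h1
    | zero => simp
    | add x y _ _ hx hy =>
      simp only [map_add, inner_add_right]
      linarith
    | smul c x _ hx =>
      simp only [map_smul, real_inner_smul_right]
      linear_combination c * hx

end Transfer

theorem map_sum_smul_eq_podMode {α β : ℝ} [AdmissibleOrders α β] {L l : ℕ}
    {U : Fin L → ℝ × ℝ → ℝ} (hU : ∀ i, U i ∈ lipSpace) (lam : Fin l → ℝ) (a : Fin l → Fin L → ℝ)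
    (k : Fin l) : EnergySpace.toFun ((1 / Real.sqrt (L * lam k)) •
      ∑ i, a k i • EnergySpace.lift α β (U i)) = podMode U lam a k := by
  simp only [map_smul, map_sum, EnergySpace.toFun_lift (hU _), podMode]

theorem podSpace_eq_map {α β : ℝ} [AdmissibleOrders α β] {L l : ℕ}
    {U : Fin L → ℝ × ℝ → ℝ} (hU : ∀ i, U i ∈ lipSpace) (lam : Fin l → ℝ) (a : Fin l → Fin L → ℝ)
    (d : ℕ) : podSpace U lam a d = (Submodule.span ℝ ((fun k => (1 / Real.sqrt (L * lam k)) •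
      ∑ i, a k i • EnergySpace.lift α β (U i)) '' {k : Fin l | (k : ℕ) < d})).map
        EnergySpace.toFun := by
  rw [Submodule.map_span, podSpace, image_image]
  simp only [map_sum_smul_eq_podMode hU]

theorem span_preimage_podSpace {α β : ℝ} [AdmissibleOrders α β] {L l : ℕ}
    {U : Fin L → ℝ × ℝ → ℝ} (hU : ∀ i, U i ∈ lipSpace) (lam : Fin l → ℝ) (a : Fin l → Fin L → ℝ)
    (d : ℕ) : Submodule.span ℝ (EnergySpace.toFun ⁻¹' (podSpace U lam a d : Set (ℝ × ℝ → ℝ)))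
      = Submodule.span ℝ ((fun k => (1 / Real.sqrt (L * lam k)) •
      ∑ i, a k i • EnergySpace.lift α β (U i)) '' {k : Fin l | (k : ℕ) < d}) := by
  rw [podSpace_eq_map (α := α) (β := β) hU, ← Submodule.comap_coe, Submodule.span_eq,
    Submodule.comap_map_eq_of_injective EnergySpace.toFun_injective]

/-! ### Runs of the method -/

section Run

variable {α β T : ℝ} {𝒯 : Geometry.SimplicialComplex ℝ (ℝ × ℝ)} {m : ℕ}
  {f : ℝ → ℝ × ℝ → ℝ} {N : ℕ} {u : ℕ → ℝ × ℝ → ℝ} {L : ℕ} {ν : Fin L → ℕ} {l : ℕ}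
  {lam : Fin l → ℝ} {a : Fin l → Fin L → ℝ} {d : ℕ} {ud : ℕ → ℝ × ℝ → ℝ}

theorem IsRun.mem_lipSpace (hr : IsRun α β T 𝒯 m f N u ν lam a d ud) {n : ℕ} (hn : n ≤ N) :
    u n ∈ lipSpace := feSpace_subset_lipSpace hr.triangulation m (hr.fe.1 n hn)

theorem IsRun.podSpace_le (hr : IsRun α β T 𝒯 m f N u ν lam a d ud) :
    podSpace (fun i => u (ν i)) lam a d ≤ lipSpace := by
  rw [podSpace, Submodule.span_le]
  rintro _ ⟨k, -, rfl⟩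
  exact lipSpace.smul_mem _ (lipSpace.sum_mem fun i _ =>
    lipSpace.smul_mem _ (hr.mem_lipSpace (hr.range i).2))

theorem IsRun.stability [AdmissibleOrders α β] (hr : IsRun α β T 𝒯 m f N u ν lam a d ud)
    (hT : 0 < T) {ε : ℝ} (hε : 0 < ε) {n : ℕ} (hn : n ≤ N) :
    l2norm (ud n) ^ 2 + 2 * step T N * ∑ i ∈ Finset.Icc 1 n, wForm α β (ud i) (ud i)
      ≤ (1 / ε + 2) * T * step T N * ∑ i ∈ Finset.Icc 1 n, l2norm (f (i * step T N)) ^ 2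
        + (1 + ε) * l2norm (ud 0) ^ 2 := by
  have h1 := (IsEulerGalerkin.lift hr.reduced hr.podSpace_le hT hr.one_le_steps
    hr.source).stability (step_nonneg hT N) (step_mul T hr.one_le_steps) hε hn
  have hlift : ∀ i ≤ N, EnergySpace.toFun (EnergySpace.lift α β (ud i)) = ud i := fun i hi =>
    EnergySpace.toFun_lift (hr.podSpace_le (hr.reduced.1 i hi))
  have e1 : ∑ i ∈ Finset.Icc 1 n, ‖EnergySpace.lift α β (ud i)‖ ^ 2
      = ∑ i ∈ Finset.Icc 1 n, wForm α β (ud i) (ud i) :=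
    Finset.sum_congr rfl fun i hi => by
      rw [EnergySpace.norm_sq_eq, hlift i ((Finset.mem_Icc.1 hi).2.trans hn)]
  have e2 : ∑ i ∈ Finset.Icc 1 n, ‖l2Class (f (i * step T N))‖ ^ 2
      = ∑ i ∈ Finset.Icc 1 n, l2norm (f (i * step T N)) ^ 2 :=
    Finset.sum_congr rfl fun i hi => by
      rw [norm_l2Class (hr.source _ (mul_step_mem hT hr.one_le_steps
        ((Finset.mem_Icc.1 hi).2.trans hn)))]
  rw [e1, e2, EnergySpace.norm_toLp_eq, EnergySpace.norm_toLp_eq, hlift n hn,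
    hlift 0 (Nat.zero_le _)] at h1
  exact h1

theorem IsRun.error_le [AdmissibleOrders α β] (hr : IsRun α β T 𝒯 m f N u ν lam a d ud)
    (hT : 0 < T) (hν : IsUniform N ν) {σ : ℝ} (hσ : (N : ℝ) ≤ σ * L) {C : ℝ} (hC0 : 0 ≤ C)
    (hC : ∀ x : EnergySpace α β, ‖EnergySpace.toLp x‖ ≤ C * ‖x‖) {K : ℝ} (hK : 0 ≤ K)
    (h1 : ∀ n, n + 1 ≤ N →
      ‖EnergySpace.lift α β (u (n + 1)) - EnergySpace.lift α β (u n)‖ ≤ K * step T N)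
    (h2 : ∀ n, n + 2 ≤ N → ‖EnergySpace.lift α β (u (n + 2))
      - (2 : ℕ) • EnergySpace.lift α β (u (n + 1)) + EnergySpace.lift α β (u n)‖
        ≤ K * step T N ^ 2)
    {n : ℕ} (hn : n ≤ N) :
    l2norm (u n - ud n) ≤ C * (5 * (L * Real.sqrt (tailSum lam d))
      + (8 * σ * K + 4 * σ * K * T) * step T N) := by
  obtain ⟨r, s, hr1, hrs, hνe, hNL⟩ := hν
  have hU : ∀ i, u (ν i) ∈ lipSpace := fun i => hr.mem_lipSpace (hr.range i).2
  have hL : 1 ≤ L := by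
    rcases Nat.eq_zero_or_pos L with rfl | hL
    · have h3 := hr.pod.dim_eq
      have h4 := hr.one_le_d.trans hr.d_le
      rw [range_eq_empty, Submodule.span_empty, finrank_bot] at h3
      omega
    · exact hL
  have hlast : r + (L - 1) * s ≤ N := by
    have h3 := (hr.range ⟨L - 1, by omega⟩).2
    rwa [hνe] at h3
  set x : ℕ → EnergySpace α β := fun n => EnergySpace.lift α β (u n) with hx
  have hxν : ∀ i, EnergySpace.toFun (x (ν i)) = u (ν i) := fun i => EnergySpace.toFun_lift (hU i)
  have hd := IsEulerGalerkin.lift hr.reduced hr.podSpace_le hT hr.one_le_steps hr.source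
  have hu := IsEulerGalerkin.lift hr.fe (feSpace_subset_lipSpace hr.triangulation m) hT
    hr.one_le_steps hr.source
  set W := Submodule.span ℝ (EnergySpace.toFun ⁻¹'
    (podSpace (fun i => u (ν i)) lam a d : Set (ℝ × ℝ → ℝ))) with hWdef
  have hW : W = Submodule.span ℝ ((fun k => (1 / Real.sqrt (L * lam k)) •
      ∑ i : Fin L, a k i • x (ν i)) '' {k : Fin l | (k : ℕ) < d}) :=
    span_preimage_podSpace hU lam a d
  have hWX : W ≤ Submodule.span ℝ (EnergySpace.toFun ⁻¹' feSpace α β 𝒯 m) := by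
    rw [hW, Submodule.span_le]
    rintro _ ⟨k, -, rfl⟩
    exact Submodule.smul_mem _ _ (Submodule.sum_mem _ fun i _ =>
      Submodule.smul_mem _ _ (hu.mem _ (hr.range i).2))
  have hdim : l = Module.finrank ℝ (Submodule.span ℝ (Set.range fun i => x (ν i))) := by
    have hmap : Submodule.span ℝ (Set.range fun i => u (ν i))
        = (Submodule.span ℝ (Set.range fun i => x (ν i))).map EnergySpace.toFun := by
      rw [Submodule.map_span, ← range_comp]
      congr 2
      ext1 i
      exact (hxν i).symm
    rw [hr.pod.dim_eq, hmap]
    exact (LinearEquiv.finrank_eq (Submodule.equivMapOfInjective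
      EnergySpace.toFun EnergySpace.toFun_injective _)).symm
  have heig : ∀ k (i : Fin L), ∑ j : Fin L, 1 / (L : ℝ) * inner ℝ (x (ν i)) (x (ν j)) * a k j
      = lam k * a k i := by
    intro k i
    have h3 := congrFun (hr.pod.eigen k) i
    simp only [EnergySpace.inner_eq, hxν]
    exact h3
  have hinit : ∀ v ∈ W, inner ℝ (EnergySpace.lift α β (ud 0)) v = inner ℝ (x 0) v := by
    intro v hv
    have hv' : EnergySpace.toFun v ∈ podSpace (fun i => u (ν i)) lam a d := by
      rw [podSpace_eq_map (α := α) (β := β) hU]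
      exact Submodule.mem_map_of_mem (hW ▸ hv)
    rw [EnergySpace.inner_eq, EnergySpace.inner_eq,
      EnergySpace.toFun_lift (hr.podSpace_le (hr.reduced.1 0 (Nat.zero_le _))),
      EnergySpace.toFun_lift (hr.mem_lipSpace (Nat.zero_le _))]
    exact hr.initial.2 _ hv'
  obtain rfl : ν = fun i : Fin L => r + i * s := funext hνe
  have herr := pod_error_le hu hd hWX (step_nonneg hT N) hinit hC0 hC
    (step_mul T hr.one_le_steps) hK hL hr1 hrs hlast hNL hσ lam a hdim hr.pod.pos heig
    hr.pod.orthonormal d hW h1 h2 hn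
  rw [EnergySpace.norm_toLp_eq, map_sub, EnergySpace.toFun_lift (hr.mem_lipSpace hn),
    EnergySpace.toFun_lift (hr.podSpace_le (hr.reduced.1 n hn))] at herr
  exact herr

theorem finiteDimensional_span_preimage_feSpace [AdmissibleOrders α β] (h : IsTriangulation 𝒯)
    (m : ℕ) : FiniteDimensional ℝ (Submodule.span ℝ
      ((EnergySpace.toFun : EnergySpace α β →ₗ[ℝ] _) ⁻¹' feSpace α β 𝒯 m)) := by
  have hfin := finiteDimensional_span_feSpace (α := α) (β := β) h m
  have hle : (Submodule.span ℝ ((EnergySpace.toFun : EnergySpace α β →ₗ[ℝ] _) ⁻¹'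
      feSpace α β 𝒯 m)).map EnergySpace.toFun ≤ Submodule.span ℝ (feSpace α β 𝒯 m) := by
    rw [Submodule.map_span]
    exact Submodule.span_mono (image_preimage_subset _ _)
  have := Submodule.finiteDimensional_of_le hle
  exact LinearEquiv.finiteDimensional (Submodule.equivMapOfInjective EnergySpace.toFun
    EnergySpace.toFun_injective _).symm

/-- For fixed data, first and second differences of the finite element solution are `O(τ)` and
`O(τ²)` in the energy norm, uniformly in the number of time steps. -/
theorem exists_bound_differences [AdmissibleOrders α β] (hT : 0 < T) (h𝒯 : IsTriangulation 𝒯)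
    (m : ℕ) (f : ℝ → ℝ × ℝ → ℝ) (u₀ : ℝ × ℝ → ℝ) {κ : ℝ}
    (hfL : ∀ s ∈ Set.Icc (0 : ℝ) T, ∀ t ∈ Set.Icc (0 : ℝ) T, l2norm (f t - f s) ≤ κ * |t - s|) :
    ∃ K : ℝ, 0 ≤ K ∧ ∀ (N : ℕ) (u : ℕ → ℝ × ℝ → ℝ) (L : ℕ) (ν : Fin L → ℕ) (l : ℕ)
      (lam : Fin l → ℝ) (a : Fin l → Fin L → ℝ) (d : ℕ) (ud : ℕ → ℝ × ℝ → ℝ),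
      IsRun α β T 𝒯 m f N u ν lam a d ud → u 0 = u₀ →
      (∀ n, n + 1 ≤ N →
        ‖EnergySpace.lift α β (u (n + 1)) - EnergySpace.lift α β (u n)‖ ≤ K * step T N) ∧
      (∀ n, n + 2 ≤ N → ‖EnergySpace.lift α β (u (n + 2))
        - (2 : ℕ) • EnergySpace.lift α β (u (n + 1)) + EnergySpace.lift α β (u n)‖
          ≤ K * step T N ^ 2) := by
  have hfin := finiteDimensional_span_preimage_feSpace (α := α) (β := β) h𝒯 m
  obtain ⟨Λ, hΛ, hinv⟩ := exists_norm_le_of_injective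
    (EnergySpace.toLp_injective (α := α) (β := β))
    (Submodule.span ℝ (EnergySpace.toFun ⁻¹' feSpace α β 𝒯 m))
  have h0T : (0 : ℝ) ∈ Icc 0 T := ⟨le_rfl, hT.le⟩
  have hκ : 0 ≤ κ := by
    have h1 := (Real.sqrt_nonneg _).trans (hfL 0 h0T T ⟨hT.le, le_rfl⟩)
    rw [sub_zero, abs_of_pos hT] at h1
    exact nonneg_of_mul_nonneg_left h1 hT
  set A := l2norm (f 0) + κ * T with hA
  have hA0 : 0 ≤ A := add_nonneg (Real.sqrt_nonneg _) (by positivity)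
  set K₁ := Λ * (A + Λ * ‖EnergySpace.lift α β u₀‖ + T * κ) with hK₁
  set K₂ := Λ * (κ + Λ * K₁) with hK₂
  have hK₁0 : 0 ≤ K₁ := by positivity
  refine ⟨max K₁ K₂, le_max_of_le_left hK₁0, ?_⟩
  intro N u L ν l lam a d ud hr hu0
  have hN := hr.one_le_steps
  have hτ : 0 < step T N := by
    rw [step]; positivity
  have hu := IsEulerGalerkin.lift hr.fe (feSpace_subset_lipSpace hr.triangulation m) hT
    hr.one_le_steps hr.source
  have hF : ∀ n, 1 ≤ n → n + 1 ≤ N →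
      ‖l2Class (f ((n + 1 : ℕ) * step T N)) - l2Class (f (n * step T N))‖ ≤ κ * step T N := by
    intro n _ hn
    have m1 := mul_step_mem hT hN hn
    have m2 := mul_step_mem hT hN (by omega : n ≤ N)
    rw [norm_l2Class_sub (hr.source _ m1) (hr.source _ m2)]
    refine (hfL _ m2 _ m1).trans (le_of_eq ?_)
    push_cast
    rw [add_mul, one_mul, add_sub_cancel_left, abs_of_pos hτ]
  have hF1 : 1 ≤ N → ‖l2Class (f ((1 : ℕ) * step T N))‖ ≤ A := by
    intro _
    have m1 := mul_step_mem hT hN hN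
    have h1 := norm_add_le (l2Class (f ((1 : ℕ) * step T N)) - l2Class (f 0)) (l2Class (f 0))
    rw [sub_add_cancel, norm_l2Class_sub (hr.source _ m1) (hr.source _ h0T),
      norm_l2Class (hr.source _ h0T)] at h1
    have h2 := hfL _ h0T _ m1
    rw [sub_zero, abs_of_nonneg m1.1] at h2
    have h3 : κ * ((1 : ℕ) * step T N) ≤ κ * T := mul_le_mul_of_nonneg_left m1.2 hκ
    linarith
  obtain ⟨b1, b2⟩ := hu.diff_le hτ (step_mul T hN) hΛ hA0 hκ hinv hF1 hF
  rw [hu0] at b1 b2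
  exact ⟨fun n hn => (b1 n hn).trans (by gcongr; exact le_max_left _ _),
    fun n hn => (b2 n hn).trans (by gcongr; exact le_max_right _ _)⟩

end Run

/-- The error estimate, with a constant depending only on the orders, `T`, `σ` and the bound `K` for
the difference quotients of the finite element solution. -/
theorem exists_error_const (α β : ℝ) [AdmissibleOrders α β] {T σ K : ℝ} (hT : 0 < T) (hσ : 0 < σ)
    (hK : 0 ≤ K) : ∃ M : ℝ, 0 < M ∧
    ∀ (𝒯 : Geometry.SimplicialComplex ℝ (ℝ × ℝ)) (m : ℕ) (f : ℝ → ℝ × ℝ → ℝ) (N : ℕ)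
      (u : ℕ → ℝ × ℝ → ℝ) (L : ℕ) (ν : Fin L → ℕ) (l : ℕ) (lam : Fin l → ℝ)
      (a : Fin l → Fin L → ℝ) (d : ℕ) (ud : ℕ → ℝ × ℝ → ℝ),
      IsRun α β T 𝒯 m f N u ν lam a d ud → IsUniform N ν → (N : ℝ) ≤ σ * L →
      (∀ n, n + 1 ≤ N →
        ‖EnergySpace.lift α β (u (n + 1)) - EnergySpace.lift α β (u n)‖ ≤ K * step T N) →
      (∀ n, n + 2 ≤ N → ‖EnergySpace.lift α β (u (n + 2))
        - (2 : ℕ) • EnergySpace.lift α β (u (n + 1)) + EnergySpace.lift α β (u n)‖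
          ≤ K * step T N ^ 2) →
      ∀ n ≤ N, l2norm (u n - ud n) ≤ M * L * Real.sqrt (tailSum lam d) + M * step T N := by
  obtain ⟨C, hC0, hC⟩ := EnergySpace.exists_norm_toLp_le α β
  refine ⟨C * (5 + (8 * σ * K + 4 * σ * K * T)), by positivity, ?_⟩
  intro 𝒯 m f N u L ν l lam a d ud hr hν hNL h1 h2 n hn
  refine (hr.error_le hT hν hNL hC0.le hC hK h1 h2 hn).trans ?_
  have hτ := step_nonneg hT N
  set R := Real.sqrt (tailSum lam d)
  have hR : 0 ≤ R := Real.sqrt_nonneg _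
  have e1 : 0 ≤ C * ((8 * σ * K + 4 * σ * K * T) * (L * R)) := by positivity
  have e2 : 0 ≤ C * (5 * step T N) := by positivity
  linarith

end RieszPOD

open RieszPOD
theorem theorem5p1 :
    -- unconditional stability
    (∀ T : ℝ, 0 < T → ∀ ε : ℝ, 0 < ε → ∃ C : ℝ, 0 < C ∧
      ∀ (α β : ℝ), 1 < α → α < 2 → 1 < β → β < 2 →
      ∀ (𝒯 : Geometry.SimplicialComplex ℝ (ℝ × ℝ)) (m : ℕ) (f : ℝ → ℝ × ℝ → ℝ) (N : ℕ)
        (u : ℕ → ℝ × ℝ → ℝ) (L : ℕ) (ν : Fin L → ℕ) (l : ℕ) (lam : Fin l → ℝ)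
        (a : Fin l → Fin L → ℝ) (d : ℕ) (ud : ℕ → ℝ × ℝ → ℝ),
        IsRun α β T 𝒯 m f N u ν lam a d ud →
        ∀ n ≤ N,
          l2norm (ud n) ^ 2 + 2 * step T N * ∑ i ∈ Finset.Icc 1 n, wForm α β (ud i) (ud i)
            ≤ C * step T N * ∑ i ∈ Finset.Icc 1 n, l2norm (f (i * step T N)) ^ 2
              + (1 + ε) * l2norm (ud 0) ^ 2) ∧
    -- error estimate for fixed data, uniformly in the discretization in time and the reduction
    (∀ (α β T σ : ℝ), 1 < α → α < 2 → 1 < β → β < 2 → 0 < T → 0 < σ →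
      ∀ (𝒯 : Geometry.SimplicialComplex ℝ (ℝ × ℝ)) (m : ℕ) (f : ℝ → ℝ × ℝ → ℝ)
        (u₀ : ℝ × ℝ → ℝ) (K : ℝ),
        (∀ s ∈ Set.Icc (0 : ℝ) T, ∀ t ∈ Set.Icc (0 : ℝ) T, l2norm (f t - f s) ≤ K * |t - s|) →
        ∃ M : ℝ, 0 < M ∧
        ∀ (N : ℕ) (u : ℕ → ℝ × ℝ → ℝ) (L : ℕ) (ν : Fin L → ℕ) (l : ℕ) (lam : Fin l → ℝ)
          (a : Fin l → Fin L → ℝ) (d : ℕ) (ud : ℕ → ℝ × ℝ → ℝ),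
          IsRun α β T 𝒯 m f N u ν lam a d ud → u 0 = u₀ → IsUniform N ν → (N : ℝ) ≤ σ * L →
          ∀ n ≤ N,
            l2norm (u n - ud n) ≤ M * L * Real.sqrt (tailSum lam d) + M * step T N) ∧
    -- error estimate uniformly in the mesh as well, the constant depending on the finite element
    -- solution only through a bound for its first two difference quotients in time
    (∀ (α β T σ K : ℝ), 1 < α → α < 2 → 1 < β → β < 2 → 0 < T → 0 < σ → 0 < K →
      ∃ M : ℝ, 0 < M ∧
      ∀ (𝒯 : Geometry.SimplicialComplex ℝ (ℝ × ℝ)) (m : ℕ) (f : ℝ → ℝ × ℝ → ℝ) (N : ℕ)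
        (u : ℕ → ℝ × ℝ → ℝ) (L : ℕ) (ν : Fin L → ℕ) (l : ℕ) (lam : Fin l → ℝ)
        (a : Fin l → Fin L → ℝ) (d : ℕ) (ud : ℕ → ℝ × ℝ → ℝ),
        IsRun α β T 𝒯 m f N u ν lam a d ud → IsUniform N ν → (N : ℝ) ≤ σ * L →
        (∀ n, n + 1 ≤ N →
          wForm α β (u (n + 1) - u n) (u (n + 1) - u n) ≤ (K * step T N) ^ 2) →
        (∀ n, n + 2 ≤ N →
          wForm α β (u (n + 2) - 2 • u (n + 1) + u n) (u (n + 2) - 2 • u (n + 1) + u n)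
            ≤ (K * step T N ^ 2) ^ 2) →
        ∀ n ≤ N,
          l2norm (u n - ud n) ≤ M * L * Real.sqrt (tailSum lam d) + M * step T N) := by
  refine ⟨?_, ?_, ?_⟩
  · intro T hT ε hε
    refine ⟨(1 / ε + 2) * T, by positivity, ?_⟩
    intro α β hα1 hα2 hβ1 hβ2 𝒯 m f N u L ν l lam a d ud hr n hn
    have : AdmissibleOrders α β := ⟨hα1, hα2, hβ1, hβ2⟩
    exact hr.stability hT hε hn
  · intro α β T σ hα1 hα2 hβ1 hβ2 hT hσ 𝒯 m f u₀ κ hf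
    have : AdmissibleOrders α β := ⟨hα1, hα2, hβ1, hβ2⟩
    by_cases h𝒯 : IsTriangulation 𝒯
    · obtain ⟨K, hK, hdiff⟩ := exists_bound_differences (α := α) (β := β) hT h𝒯 m f u₀ hf
      obtain ⟨M, hM, herr⟩ := exists_error_const α β hT hσ hK
      refine ⟨M, hM, ?_⟩
      intro N u L ν l lam a d ud hr hu0 hν hNL n hn
      obtain ⟨h1, h2⟩ := hdiff N u L ν l lam a d ud hr hu0
      exact herr 𝒯 m f N u L ν l lam a d ud hr hν hNL h1 h2 n hn
    · exact ⟨1, one_pos, fun N u L ν l lam a d ud hr => absurd hr.triangulation h𝒯⟩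
  · intro α β T σ K hα1 hα2 hβ1 hβ2 hT hσ hK
    have : AdmissibleOrders α β := ⟨hα1, hα2, hβ1, hβ2⟩
    obtain ⟨M, hM, herr⟩ := exists_error_const α β hT hσ hK.le
    refine ⟨M, hM, ?_⟩
    intro 𝒯 m f N u L ν l lam a d ud hr hν hNL h1 h2 n hn
    have hτ := step_nonneg hT N
    have hlift : ∀ n ≤ N, EnergySpace.toFun (EnergySpace.lift α β (u n)) = u n := fun n hn =>
      EnergySpace.toFun_lift (hr.mem_lipSpace hn)
    refine herr 𝒯 m f N u L ν l lam a d ud hr hν hNL (fun n hn => ?_) (fun n hn => ?_) n hn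
    · refine (sq_le_sq₀ (norm_nonneg _) (by positivity)).1 ?_
      rw [EnergySpace.norm_sq_eq, map_sub, hlift n (by omega), hlift (n + 1) hn]
      exact h1 n hn
    · refine (sq_le_sq₀ (norm_nonneg _) (by positivity)).1 ?_
      rw [EnergySpace.norm_sq_eq, map_add, map_sub, map_nsmul, hlift n (by omega),
        hlift (n + 1) (by omega), hlift (n + 2) hn]
      exact h2 n hn
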